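/- Let $(M,g)$ be a compact smooth Riemannian manifold without boundary, of dimension $d$, with Riemannian volume $\mathrm{vol}$. Let $U\in C^1(M)$ be such that $\pi(dx)=e^{-U(x)}\,\mathrm{vol}(dx)$ is a probability measure, and let $b$ be a $C^1$ vector field on $M$ with $\operatorname{div}(e^{-U}b)=0$. Let $L^2(M,\pi)$ be the real Hilbert space with $\langle f,h\rangle=\int_M fh\,d\pi$, and let $(\mathcal E,H^1)$ be the closure in $L^2(M,\pi)$ of the form $\mathcal E(f,h)=\int_M\nabla f\cdot\nabla h\,d\pi$ on $C^\infty(M)$; convergence in $H^1$ is with respect to $\mathcal E(u,u)+\|u\|^2$. Let $(A,\mathrm{Dom}(A))$ be the Friedrichs extension in $L^2(M,\pi)$ of $f\mapsto\Delta f-\nabla U\cdot\nabla f$ on $C^\infty(M)$, let $B:H^1\to L^2(M,\pi)$ be the extension by continuity of $f\mapsto b\cdot\nabla f$ on $C^\infty(M)$, and for $c\in\mathbb R$ put $A_c=A+cB$ on $\mathrm{Dom}(A_c)=\mathrm{Dom}(A)$. Theorem. For all $c\in\mathbb R$ and $\lambda>0$ the resolvent $R^{(c)}_\lambda=(\lambda-A_c)^{-1}=-(A_c-\lambda)^{-1}$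 exists as a bounded operator on $L^2(M,\pi)$. For every $\lambda>0$ there is a bounded operator $R^*_\lambda$ on $L^2(M,\pi)$ such that $R^{(c)}_\lambda f\to R^*_\lambda f$ in $H^1$ as $|c|\to\infty$ for all $f\in L^2(M,\pi)$. The family $(R^*_\lambda)_{\lambda>0}$ is a self-adjoint pseudo-resolvent, i.e. $$(\mu-\lambda)R^*_\lambda R^*_\mu=R^*_\lambda-R^*_\mu\qquad\text{for all }\lambda,\mu>0,$$ and each $R^*_\lambda$ is self-adjoint. Moreover the adjoint of $R^{(c)}_\lambda$ is $R^{(-c)}_\lambda$ for all $c\in\mathbb R$, $\lambda>0$, and all operators $R^{(c)}_\lambda$ and $R^*_\lambda$ map the subspace $\{f\in L^2(M,\pi):\int_M f\,d\pi=0\}$ into itself. -/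

import Mathlib

open scoped Manifold ContDiff ENNReal Topology
open MeasureTheory Filter

noncomputable section

namespace DriftHomogenization

/-- Smooth (`C^∞`) Riemannian metrics on a `d`-dimensional manifold `M`. -/
abbrev Metric (d : ℕ) (M : Type*) [TopologicalSpace M]
    [ChartedSpace (EuclideanSpace ℝ (Fin d)) M] [IsManifold (𝓡 d) ∞ M] : Type _ :=
  Bundle.ContMDiffRiemannianMetric (𝓡 d) ∞ (EuclideanSpace ℝ (Fin d))
    (fun x : M => TangentSpace (𝓡 d) x)

/-- The space `C^∞(M)` of smooth real valued functions. -/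
abbrev SmoothFn (d : ℕ) (M : Type*) [TopologicalSpace M]
    [ChartedSpace (EuclideanSpace ℝ (Fin d)) M] : Type _ :=
  C^∞⟮𝓡 d, M; 𝓘(ℝ, ℝ), ℝ⟯

variable {d : ℕ} {M : Type*} [TopologicalSpace M]
  [ChartedSpace (EuclideanSpace ℝ (Fin d)) M] [IsManifold (𝓡 d) ∞ M]

/-! ### Riemannian geometry in local coordinates -/

/-- The coordinate vector field `∂_{x_j}` of the chart `e`, at the point with coordinates `y`. -/
def coordField (e : OpenPartialHomeomorph M (EuclideanSpace ℝ (Fin d)))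
    (j : Fin d) (y : EuclideanSpace ℝ (Fin d)) : TangentSpace (𝓡 d) (e.symm y) :=
  mfderiv 𝓘(ℝ, EuclideanSpace ℝ (Fin d)) (𝓡 d) e.symm y
    ((NormedSpace.fromTangentSpace y).symm (EuclideanSpace.single j (1 : ℝ)))

/-- The matrix `G = (g_{jk})` of the metric in the chart `e`, `g_{jk} = g(∂_{x_j}, ∂_{x_k})`. -/
def gramMatrix (g : Metric d M) (e : OpenPartialHomeomorph M (EuclideanSpace ℝ (Fin d)))
    (y : EuclideanSpace ℝ (Fin d)) : Matrix (Fin d) (Fin d) ℝ :=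
  Matrix.of fun j k => g.inner (e.symm y) (coordField e j y) (coordField e k y)

/-- The density `√g = √(det G)` in the chart `e`. -/
def sqrtDet (g : Metric d M) (e : OpenPartialHomeomorph M (EuclideanSpace ℝ (Fin d)))
    (y : EuclideanSpace ℝ (Fin d)) : ℝ :=
  √(gramMatrix g e y).det

/-- The measure on `M`, carried by the domain of the chart `e`, which in the coordinates of `e`
is `√g dx`. -/
def chartVolume [MeasurableSpace M] (g : Metric d M)
    (e : OpenPartialHomeomorph M (EuclideanSpace ℝ (Fin d))) : Measure M :=
  ((volume.restrict e.target).withDensity fun y => ENNReal.ofReal (sqrtDet g e y)).map e.symm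

/-- The Riemannian volume measure: the smallest measure which dominates `√g dx` in every chart of
the atlas. As the measures `√g dx` of two charts agree on the overlap of their domains, this is the
measure which on the domain of each chart equals `√g dx`. -/
def riemannianVolume [MeasurableSpace M] (g : Metric d M) : Measure M :=
  ⨆ e ∈ atlas (EuclideanSpace ℝ (Fin d)) M, chartVolume g e

/-- The measure `π(dx) = exp(-U(x)) vol(dx)`. -/
def gibbsMeasure [MeasurableSpace M] (g : Metric d M) (U : M → ℝ) : Measure M :=
  (riemannianVolume g).withDensity fun x => ENNReal.ofReal (Real.exp (-U x))

/-- The inner product of `g` at `x` as a bilinear form on the tangent space. -/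
def innerForm (g : Metric d M) (x : M) :
    LinearMap.BilinForm ℝ (TangentSpace (𝓡 d) x) :=
  LinearMap.mk₂ ℝ (fun v w => g.inner x v w) (by simp) (by simp) (by simp) (by simp)

theorem innerForm_nondegenerate (g : Metric d M) (x : M) : (innerForm g x).Nondegenerate := by
  have h : ∀ v : TangentSpace (𝓡 d) x, g.inner x v v = 0 → v = 0 := by
    intro v hv
    by_contra hne
    exact absurd hv (g.pos x v hne).ne'
  exact ⟨fun v hv => h v (hv v), fun v hv => h v (hv v)⟩

instance finiteDimensional_tangentSpace (x : M) :
    FiniteDimensional ℝ (TangentSpace (𝓡 d) x) :=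
  inferInstanceAs (FiniteDimensional ℝ (EuclideanSpace ℝ (Fin d)))

/-- The Riemannian gradient: `∇f(x)` is the tangent vector with `g(∇f(x), v) = df_x(v)` for
all `v ∈ T_x M`. -/
def grad (g : Metric d M) (f : M → ℝ) (x : M) : TangentSpace (𝓡 d) x :=
  ((innerForm g x).toDual (innerForm_nondegenerate g x)).symm
    (mvfderiv (𝓡 d) f x).toLinearMap

theorem inner_grad (g : Metric d M) (f : M → ℝ) (x : M) (v : TangentSpace (𝓡 d) x) :
    g.inner x (grad g f x) v = mvfderiv (𝓡 d) f x v :=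
  LinearMap.BilinForm.apply_toDual_symm_apply (B := innerForm g x) _ v

/-- The component `η^j` of the vector field `X = ∑_j η^j ∂_{x_j}` in the chart `e`, as a function of
the coordinates. -/
def component (e : OpenPartialHomeomorph M (EuclideanSpace ℝ (Fin d)))
    (X : ∀ x : M, TangentSpace (𝓡 d) x) (j : Fin d) (y : EuclideanSpace ℝ (Fin d)) : ℝ :=
  mvfderiv (𝓡 d) e (e.symm y) (X (e.symm y)) j

/-- The divergence `div X = (1/√g) ∑_j ∂_{x_j} (η^j √g)`, computed at `x` in the chart at `x`. -/
def divergence (g : Metric d M) (X : ∀ x : M, TangentSpace (𝓡 d) x) (x : M) : ℝ :=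
  let e := chartAt (EuclideanSpace ℝ (Fin d)) x
  (sqrtDet g e (e x))⁻¹ *
    ∑ j : Fin d, fderiv ℝ (fun y => component e X j y * sqrtDet g e y) (e x)
      (EuclideanSpace.single j (1 : ℝ))

/-- The Laplace operator `Δf = div ∇f = (1/√g) ∑_{j,k} ∂_{x_j} (g^{jk} √g ∂_{x_k} f)`. -/
def laplacian (g : Metric d M) (f : M → ℝ) (x : M) : ℝ :=
  divergence g (grad g f) x

/-- The differential operator `A_o f = Δf - ∇U · ∇f`. -/
def diffOp (g : Metric d M) (U : M → ℝ) (f : M → ℝ) (x : M) : ℝ :=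
  laplacian g f x - g.inner x (grad g U x) (grad g f x)

/-- The first order differential operator `f ↦ b · ∇f`. -/
def driftOp (g : Metric d M) (b : ∀ x : M, TangentSpace (𝓡 d) x) (f : M → ℝ) (x : M) : ℝ :=
  g.inner x (b x) (grad g f x)

/-! ### The Sobolev space `H¹`, the Friedrichs extension and the resolvents -/

variable [MeasurableSpace M]

/-- The Hilbert space `L²(M, π)` of real valued square integrable functions. -/
abbrev L2 (g : Metric d M) (U : M → ℝ) : Type _ := Lp ℝ 2 (gibbsMeasure g U)

/-- The energy `∫ ∇f · ∇f dπ` of a smooth function. -/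
def smoothEnergy (g : Metric d M) (U : M → ℝ) (f : SmoothFn d M) : ℝ :=
  ∫ x, g.inner x (grad g f x) (grad g f x) ∂(gibbsMeasure g U)

/-- `f_n ∈ C^∞(M)` is a Cauchy sequence for the Dirichlet form `∫ ∇f · ∇h dπ` which converges
in `L²(M, π)` to `u`. -/
def IsH1Approx (g : Metric d M) (U : M → ℝ) (f : ℕ → SmoothFn d M) (u : L2 g U) : Prop :=
  Tendsto (fun n => eLpNorm (fun x => f n x - u x) 2 (gibbsMeasure g U)) atTop (𝓝 0) ∧
  Tendsto (fun p : ℕ × ℕ => smoothEnergy g U (f p.1 - f p.2)) atTop (𝓝 0)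

/-- `H¹`: the domain of the closure of the Dirichlet form `∫ ∇f · ∇h dπ`, `f, h ∈ C^∞(M)`. -/
def H1 (g : Metric d M) (U : M → ℝ) : Set (L2 g U) :=
  {u | ∃ f : ℕ → SmoothFn d M, IsH1Approx g U f u}

/-- The closed Dirichlet form `ℰ(u, u)` on `H¹`, the limit of the energies of the approximating
smooth functions, with the value `∞` outside of `H¹`. (The form is closable, hence the limit does
not depend on the approximating sequence and the infimum is taken over equal values.) -/
def energy (g : Metric d M) (U : M → ℝ) (u : L2 g U) : ℝ≥0∞ :=
  ⨅ (f : ℕ → SmoothFn d M) (_ : IsH1Approx g U f u),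
    liminf (fun n => ENNReal.ofReal (smoothEnergy g U (f n))) atTop

/-- The square `ℰ(u, u) + ‖u‖²` of the norm of `H¹`. -/
def h1NormSq (g : Metric d M) (U : M → ℝ) (u : L2 g U) : ℝ≥0∞ :=
  energy g U u + ‖u‖ₑ ^ 2

/-- The graph of the Friedrichs extension `(A, Dom A)` of `(A_o, C^∞(M))` in `L²(M, π)`, that is, of
the restriction of the adjoint of `A_o` to the domain `H¹` of the closed form. -/
def friedrichsGraph (g : Metric d M) (U : M → ℝ) : Set (L2 g U × L2 g U) :=
  {p | p.1 ∈ H1 g U ∧ ∀ v : SmoothFn d M,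
    ∫ x, p.1 x * diffOp g U v x ∂(gibbsMeasure g U) = ∫ x, p.2 x * v x ∂(gibbsMeasure g U)}

/-- The graph of `B : H¹ → L²(M, π)`, the extension of `f ↦ b · ∇f` from `C^∞(M)` to `H¹` by
continuity: `B u = lim b · ∇f_n` if `f_n → u` in `H¹`. -/
def driftGraph (g : Metric d M) (U : M → ℝ) (b : ∀ x : M, TangentSpace (𝓡 d) x) :
    Set (L2 g U × L2 g U) :=
  {p | ∃ f : ℕ → SmoothFn d M, IsH1Approx g U f p.1 ∧
    Tendsto (fun n => eLpNorm (fun x => driftOp g b (f n) x - p.2 x) 2 (gibbsMeasure g U))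
      atTop (𝓝 0)}

/-- The graph of the operator `A_c = A + c B` with domain `Dom A`. -/
def generatorGraph (g : Metric d M) (U : M → ℝ) (b : ∀ x : M, TangentSpace (𝓡 d) x) (c : ℝ) :
    Set (L2 g U × L2 g U) :=
  {p | ∃ a h : L2 g U, (p.1, a) ∈ friedrichsGraph g U ∧ (p.1, h) ∈ driftGraph g U b ∧
    p.2 = a + c • h}

/-- The bounded operator `R` is the resolvent `(λ - T)⁻¹ = -(T - λ)⁻¹` of the operator `T` with
graph `Γ`: one has `R f ∈ Dom T` and `(λ - T) R f = f` for all `f`, and `R (λ - T) u = u` for all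
`u ∈ Dom T`. -/
def IsResolventAt {H : Type*} [NormedAddCommGroup H] [NormedSpace ℝ H]
    (Γ : Set (H × H)) (lam : ℝ) (R : H →L[ℝ] H) : Prop :=
  (∀ f : H, (R f, lam • R f - f) ∈ Γ) ∧ ∀ p ∈ Γ, R (lam • p.1 - p.2) = p.1

end DriftHomogenization

end

noncomputable section

namespace DriftHomogenization

/-! ### Hilbert space completions of positive forms -/

section Abstract

open scoped InnerProductSpace

/-! Fix `lam > 0` and let `V` be `H¹` with the inner product `ℰ(u, v) + lam ⟨u, v⟩`. The inclusion
`V → L²` and the drift `B : V → L²` are bounded. Let `J : L² → V` be the adjoint of the inclusion;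
by the weak form of the equation, `J` is `(lam - A)⁻¹` viewed as a map into `V`. Put `S = J B`. Then
`⟨S x, y⟩_V = ⟨B x, y⟩`, so `S` is a bounded antisymmetric operator on `V`, and `(lam - A - c B) u =
f` becomes `u - c S u = J f`. Hence the resolvent is the inclusion composed with `(1 - c S)⁻¹ J`.

Antisymmetry gives `⟨u - c S u, u⟩ = ‖u‖²`, so by Lax-Milgram `1 - c S` is invertible, and its
inverse is a contraction for every `c` (`exists_inverse_one_sub_smul`, `norm_le_norm_sub_smul`). The
inverse fixes `ker S` and sends `S w` to `c⁻¹ ((1 - c S)⁻¹ w - w)`, which tends to `0`. Since `V` is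
the orthogonal sum of `ker S` and the closure of `range S`, the inverses converge strongly in `V` to
the orthogonal projection onto `ker S` (`tendsto_inverse_one_sub_smul`). Convergence in `V` is
convergence in `H¹`.

The space `V` depends on `lam`, so each `lam` is treated separately (`DriftForm.exists_resolvent`).
The resolvent identity holds for finite `c` because all `lam` share one graph, and it passes to the
limit by the bound uniform in `c`. The adjoint changes `c` into `-c`, which leaves `|c| → ∞`
unchanged, so the limit is self-adjoint. Constants are eigenfunctions of every resolvent; by
duality, mean zero is preserved.

The geometry enters through three facts on smooth functions: `-(Δ - ∇U · ∇)` represents the form, `b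
· ∇` is antisymmetric in `L²(π)`, and `|b|` is bounded. The first two reduce to the divergence
theorem `HasC1Components.integral_mvfderiv`, obtained from integration by parts in charts and a
partition of unity. -/

/-- A symmetric positive semidefinite bilinear form is the pull back of the inner product under a
linear map with dense range into a Hilbert space. -/
theorem exists_hilbert_completion.{u} {D : Type u} [AddCommGroup D] [Module ℝ D]
    (F : D →ₗ[ℝ] D →ₗ[ℝ] ℝ) (hsymm : ∀ f v, F f v = F v f) (hnonneg : ∀ f, 0 ≤ F f f) :
    ∃ (V : Type u) (_ : NormedAddCommGroup V) (_ : InnerProductSpace ℝ V) (_ : CompleteSpace V)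
      (κ : D →ₗ[ℝ] V), DenseRange κ ∧ ∀ f v, ⟪κ f, κ v⟫_ℝ = F f v := by
  let core : PreInnerProductSpace.Core ℝ D :=
    { inner := fun f v => F f v
      conj_inner_symm := fun f v => by simp [hsymm f v]
      re_inner_nonneg := fun f => by simpa using hnonneg f
      add_left := fun f v w => by simp
      smul_left := fun f v r => by simp }
  let : SeminormedAddCommGroup D := InnerProductSpace.Core.toSeminormedAddCommGroup (𝕜 := ℝ)
  let : InnerProductSpace ℝ D := InnerProductSpace.ofCore core
  refine ⟨UniformSpace.Completion D, inferInstance, inferInstance, inferInstance,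
    (UniformSpace.Completion.toComplL (𝕜 := ℝ) (E := D)).toLinearMap, ?_, ?_⟩
  · exact UniformSpace.Completion.denseRange_coe
  · intro f v
    exact UniformSpace.Completion.inner_coe f v

/-! ### Resolvents of an antisymmetric operator with a large coupling constant -/

section Antisymmetric

variable {V : Type*} [NormedAddCommGroup V] [InnerProductSpace ℝ V] {S : V →L[ℝ] V}

theorem inner_self_eq_zero_of_antisymm (hS : ∀ u v, ⟪S u, v⟫_ℝ = -⟪u, S v⟫_ℝ) (u : V) :
    ⟪S u, u⟫_ℝ = 0 := by
  have := hS u u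
  rw [real_inner_comm (S u) u] at this
  linarith

theorem inner_sub_smul_self (hS : ∀ u v, ⟪S u, v⟫_ℝ = -⟪u, S v⟫_ℝ) (c : ℝ) (u : V) :
    ⟪u - c • S u, u⟫_ℝ = ‖u‖ ^ 2 := by
  rw [inner_sub_left, real_inner_smul_left, inner_self_eq_zero_of_antisymm hS,
    real_inner_self_eq_norm_sq]
  ring

/-- Pairing `u - c • S u` with `u` removes the drift term, so Cauchy-Schwarz gives a bound
independent of `c`. -/
theorem norm_le_norm_sub_smul (hS : ∀ u v, ⟪S u, v⟫_ℝ = -⟪u, S v⟫_ℝ) (c : ℝ) (u : V) :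
    ‖u‖ ≤ ‖u - c • S u‖ := by
  have h := inner_sub_smul_self hS c u
  have h' := real_inner_le_norm (u - c • S u) u
  by_contra! hlt
  nlinarith [norm_nonneg u, norm_nonneg (u - c • S u)]

/-- Lax-Milgram: the bilinear form of `1 - c S` is coercive with constant `1`, for every real `c`.
-/
theorem exists_inverse_one_sub_smul [CompleteSpace V] (hS : ∀ u v, ⟪S u, v⟫_ℝ = -⟪u, S v⟫_ℝ) (c : ℝ) :
    ∃ T : V →L[ℝ] V, (∀ h, T h - c • S (T h) = h) ∧ ∀ u, T (u - c • S u) = u := by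
  let L : V →L[ℝ] V := ContinuousLinearMap.id ℝ V - c • S
  have hL : ∀ u, L u = u - c • S u := fun u => by simp [L]
  have hco : IsCoercive ((innerSL ℝ).comp L) := by
    refine ⟨1, one_pos, fun u => ?_⟩
    have := inner_sub_smul_self hS c u
    simp only [ContinuousLinearMap.comp_apply, innerSL_apply_apply, hL, this]
    nlinarith
  let e := hco.continuousLinearEquivOfBilin
  have he : ∀ u, e u = u - c • S u := by
    intro u
    refine ext_inner_right ℝ fun w => ?_
    rw [hco.continuousLinearEquivOfBilin_apply]
    simp [hL, inner_sub_left, real_inner_smul_left]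
  refine ⟨e.symm, fun h => ?_, fun u => ?_⟩
  · rw [← he]; exact e.apply_symm_apply h
  · rw [← he]; exact e.symm_apply_apply u

/-- The inverses of `1 - c S`, `S` antisymmetric, converge strongly to the orthogonal projection
onto the kernel of `S`. -/
theorem tendsto_inverse_one_sub_smul [CompleteSpace V] (hS : ∀ u v, ⟪S u, v⟫_ℝ = -⟪u, S v⟫_ℝ)
    (T : ℝ → V →L[ℝ] V) (hT : ∀ c h, T c h - c • S (T c h) = h)
    (hT' : ∀ c u, T c (u - c • S u) = u) :
    ∃ P : V →L[ℝ] V, ∀ h, Tendsto (fun c => T c h) (comap (fun c : ℝ => |c|) atTop) (𝓝 (P h)) := by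
  have hcontr : ∀ c h, ‖T c h‖ ≤ ‖h‖ := fun c h => by
    simpa [hT] using norm_le_norm_sub_smul hS c (T c h)
  have hadj : ContinuousLinearMap.adjoint S = -S := by
    symm
    rw [ContinuousLinearMap.eq_adjoint_iff]
    intro u v
    simp [hS]
  have : CompleteSpace S.ker := S.isClosed_ker.completeSpace_coe
  have : S.ker.HasOrthogonalProjection := inferInstance
  refine ⟨S.ker.starProjection, fun h => ?_⟩
  have hker : ∀ k ∈ S.ker, ∀ c, T c k = k := fun k hk c => by
    have hk' : S k = 0 := hk
    simpa [hk'] using hT' c k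
  -- As the adjoint of `S` is `-S`, the complement of the kernel is the closure of the range. Decay
  -- on the range extends to the closure because the `T c` are contractions.
  have hran : ∀ r ∈ S.kerᗮ, Tendsto (fun c => T c r) (comap (fun c : ℝ => |c|) atTop) (𝓝 0) := by
    intro r hr
    have hr' : r ∈ closure (S.range : Set V) := by
      rw [ContinuousLinearMap.orthogonal_ker, hadj] at hr
      rw [← Submodule.topologicalClosure_coe]
      have hrange : (-S).range = S.range := by
        ext x
        constructor
        · rintro ⟨y, rfl⟩; exact ⟨-y, by simp⟩
        · rintro ⟨y, rfl⟩; exact ⟨-y, by simp⟩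
      rwa [hrange] at hr
    rw [Metric.tendsto_nhds]
    intro ε hε
    obtain ⟨_, ⟨w, rfl⟩, hw⟩ := Metric.mem_closure_iff.1 hr' (ε / 2) (half_pos hε)
    -- The threshold makes `2‖w‖ / |c| < ε / 2`; the summand `1` keeps `c` away from `0` even when
    -- `w = 0`.
    have hev : ∀ᶠ c : ℝ in comap (fun c : ℝ => |c|) atTop, 4 * ‖w‖ / ε + 1 ≤ |c| :=
      tendsto_comap.eventually (eventually_ge_atTop _)
    filter_upwards [hev] with c hc
    have hcpos : 0 < |c| := lt_of_lt_of_le (by positivity) hc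
    have hc0 : c ≠ 0 := abs_pos.1 hcpos
    have hlt : 4 * ‖w‖ < |c| * ε := by
      have : 4 * ‖w‖ / ε < |c| := by linarith
      rwa [div_lt_iff₀ hε] at this
    -- Solve `T c (w - c • S w) = w` for `T c (S w)`.
    have hTS : T c (S w) = c⁻¹ • (T c w - w) := by
      have h1 := hT' c w
      rw [map_sub, map_smul, sub_eq_iff_eq_add] at h1
      rw [h1]
      simp [smul_smul, hc0]
    have h2 : ‖T c (S w)‖ ≤ |c|⁻¹ * (2 * ‖w‖) := by
      rw [hTS, norm_smul, norm_inv, Real.norm_eq_abs]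
      gcongr
      linarith [norm_sub_le (T c w) w, hcontr c w]
    have h3 : ‖T c (S w)‖ < ε / 2 := by
      refine lt_of_le_of_lt h2 ?_
      rw [inv_mul_lt_iff₀ hcpos]
      linarith
    have h4 : ‖T c (r - S w)‖ < ε / 2 := by
      refine lt_of_le_of_lt (hcontr c _) ?_
      simpa [dist_eq_norm] using hw
    rw [dist_zero_right]
    calc ‖T c r‖ = ‖T c (r - S w) + T c (S w)‖ := by rw [← map_add]; simp
      _ ≤ _ := norm_add_le _ _
      _ < ε := by linarith
  have hdecomp : h = S.ker.starProjection h + (h - S.ker.starProjection h) := by abel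
  have hm : h - S.ker.starProjection h ∈ S.kerᗮ := Submodule.sub_starProjection_mem_orthogonal h
  have hlim := (hran _ hm).const_add (S.ker.starProjection h)
  rw [add_zero] at hlim
  refine hlim.congr fun c => ?_
  conv_rhs => rw [hdecomp, map_add, hker _ (Submodule.starProjection_apply_mem _ _)]

end Antisymmetric

/-! ### Symmetric forms with an antisymmetric drift -/

/-- A densely defined symmetric positive form together with its generator and an antisymmetric
drift which is bounded with respect to the form, all given on a core `D`. -/
structure DriftForm (D H : Type*) [AddCommGroup D] [Module ℝ D] [NormedAddCommGroup H]
    [InnerProductSpace ℝ H] where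
  /-- The embedding of the core. -/
  emb : D →ₗ[ℝ] H
  /-- The symmetric form. -/
  form : D →ₗ[ℝ] D →ₗ[ℝ] ℝ
  /-- The generator of the form. -/
  gen : D → H
  /-- The drift. -/
  drift : D →ₗ[ℝ] H
  /-- The bound of the drift. -/
  bound : ℝ
  denseRange_emb : DenseRange emb
  form_symm : ∀ f v, form f v = form v f
  form_nonneg : ∀ f, 0 ≤ form f f
  form_eq : ∀ f v, form f v = -⟪emb f, gen v⟫_ℝ
  norm_drift_sq_le : ∀ f, ‖drift f‖ ^ 2 ≤ bound * form f f
  inner_drift : ∀ f v, ⟪drift f, emb v⟫_ℝ = -⟪emb f, drift v⟫_ℝ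

namespace DriftForm

variable {D H : Type*} [AddCommGroup D] [Module ℝ D] [NormedAddCommGroup H]
  [InnerProductSpace ℝ H] (Q : DriftForm D H)

/-- `f_n` is Cauchy for the form and converges to `u` in the Hilbert space. -/
def IsApprox (f : ℕ → D) (u : H) : Prop :=
  Tendsto (fun n => Q.emb (f n)) atTop (𝓝 u) ∧
  Tendsto (fun p : ℕ × ℕ => Q.form (f p.1 - f p.2) (f p.1 - f p.2)) atTop (𝓝 0)

/-- The domain of the closed form. -/
def formDomain : Set H := {u | ∃ f, Q.IsApprox f u}

/-- The closed form. -/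
def closedForm (u : H) : ℝ≥0∞ :=
  ⨅ (f : ℕ → D) (_ : Q.IsApprox f u),
    liminf (fun n => ENNReal.ofReal (Q.form (f n) (f n))) atTop

/-- The graph of the Friedrichs extension of the generator. -/
def genGraph : Set (H × H) :=
  {p | p.1 ∈ Q.formDomain ∧ ∀ v, ⟪p.1, Q.gen v⟫_ℝ = ⟪p.2, Q.emb v⟫_ℝ}

/-- The graph of the extension of the drift to the form domain. -/
def driftClosure : Set (H × H) :=
  {p | ∃ f, Q.IsApprox f p.1 ∧ Tendsto (fun n => Q.drift (f n)) atTop (𝓝 p.2)}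

/-- The graph of the sum of the generator and `c` times the drift. -/
def sumGraph (c : ℝ) : Set (H × H) :=
  {p | ∃ a h, (p.1, a) ∈ Q.genGraph ∧ (p.1, h) ∈ Q.driftClosure ∧ p.2 = a + c • h}

/-- A realization of the form domain as a Hilbert space `V`, with norm `form + lam ‖·‖²`. -/
structure Realization (lam : ℝ) (V : Type*) [NormedAddCommGroup V] [InnerProductSpace ℝ V] where
  /-- The embedding of the core. -/
  core : D →ₗ[ℝ] V
  /-- The embedding into the ambient space. -/
  incl : V →L[ℝ] H
  /-- The extended drift. -/
  driftOn : V →L[ℝ] H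
  denseRange_core : DenseRange core
  inner_core : ∀ f v, ⟪core f, core v⟫_ℝ = Q.form f v + lam * ⟪Q.emb f, Q.emb v⟫_ℝ
  incl_core : ∀ f, incl (core f) = Q.emb f
  driftOn_core : ∀ f, driftOn (core f) = Q.drift f

/-- Complete the core for the form plus `lam` times the ambient inner product. Both the embedding
and the drift are bounded for this norm, hence extend to the completion. -/
theorem exists_realization.{u, v} {D : Type u} {H : Type v} [AddCommGroup D] [Module ℝ D]
    [NormedAddCommGroup H] [InnerProductSpace ℝ H] [CompleteSpace H] (Q : DriftForm D H) {lam : ℝ}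
    (hlam : 0 < lam) :
    ∃ (V : Type u) (_ : NormedAddCommGroup V) (_ : InnerProductSpace ℝ V) (_ : CompleteSpace V),
      Nonempty (Q.Realization lam V) := by
  let F : D →ₗ[ℝ] D →ₗ[ℝ] ℝ := Q.form + lam • (innerₗ H).compl₁₂ Q.emb Q.emb
  have hF : ∀ f v, F f v = Q.form f v + lam * ⟪Q.emb f, Q.emb v⟫_ℝ := fun f v => by
    simp [F]
  obtain ⟨V, i1, i2, i3, κ, hdense, hκ⟩ := exists_hilbert_completion F
    (fun f v => by rw [hF, hF, Q.form_symm, real_inner_comm])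
    (fun f => by
      rw [hF, real_inner_self_eq_norm_sq]
      have := Q.form_nonneg f
      positivity)
  have hnorm : ∀ f, ‖κ f‖ ^ 2 = Q.form f f + lam * ‖Q.emb f‖ ^ 2 := fun f => by
    rw [← real_inner_self_eq_norm_sq, hκ, hF, real_inner_self_eq_norm_sq]
  have hemb : ∃ C, ∀ f, ‖Q.emb f‖ ≤ C * ‖κ f‖ := by
    -- From `lam * ‖Q.emb f‖ ^ 2 ≤ ‖κ f‖ ^ 2`.
    refine ⟨√(1 / lam), fun f => ?_⟩
    refine le_of_sq_le_sq ?_ (by positivity)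
    rw [mul_pow, Real.sq_sqrt (by positivity), hnorm]
    have := Q.form_nonneg f
    field_simp
    linarith
  have hdrift : ∃ C, ∀ f, ‖Q.drift f‖ ≤ C * ‖κ f‖ := by
    -- The sign of `Q.bound` is not prescribed, so its absolute value goes under the root.
    refine ⟨√|Q.bound|, fun f => ?_⟩
    refine le_of_sq_le_sq ?_ (by positivity)
    rw [mul_pow, Real.sq_sqrt (by positivity), hnorm]
    have h0 := Q.form_nonneg f
    calc _ ≤ _ := Q.norm_drift_sq_le f
      _ ≤ |Q.bound| * Q.form f f := by gcongr; exact le_abs_self _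
      _ ≤ _ := by gcongr; nlinarith [sq_nonneg ‖Q.emb f‖]
  refine ⟨V, i1, i2, i3, ⟨⟨κ, Q.emb.extendOfNorm κ, Q.drift.extendOfNorm κ, hdense, ?_, ?_, ?_⟩⟩⟩
  · intro f v; rw [hκ, hF]
  · exact LinearMap.extendOfNorm_eq hdense hemb
  · exact LinearMap.extendOfNorm_eq hdense hdrift

/-! ### Passage between the Hilbert space `V` and approximating sequences in the core -/

namespace Realization

variable {Q} {lam : ℝ} {V : Type*} [NormedAddCommGroup V] [InnerProductSpace ℝ V]
  (Φ : Q.Realization lam V)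

theorem norm_core_sq (f : D) : ‖Φ.core f‖ ^ 2 = Q.form f f + lam * ‖Q.emb f‖ ^ 2 := by
  rw [← real_inner_self_eq_norm_sq, Φ.inner_core, real_inner_self_eq_norm_sq]

/-- On the core this is `form_eq`, and both sides are continuous in `u`. The right side sees `u`
only through `incl u`; as the core is dense, `incl` is therefore injective, which is the closability
of the form. -/
theorem inner_core_right (u : V) (v : D) :
    ⟪u, Φ.core v⟫_ℝ = -⟪Φ.incl u, Q.gen v⟫_ℝ + lam * ⟪Φ.incl u, Q.emb v⟫_ℝ := by
  refine Φ.denseRange_core.induction_on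
    (p := fun u => ⟪u, Φ.core v⟫_ℝ = -⟪Φ.incl u, Q.gen v⟫_ℝ + lam * ⟪Φ.incl u, Q.emb v⟫_ℝ) u
    (isClosed_eq (by fun_prop) (by fun_prop)) fun f => ?_
  rw [Φ.inner_core, Q.form_eq, Φ.incl_core]

theorem inner_driftOn (u v : V) : ⟪Φ.driftOn u, Φ.incl v⟫_ℝ = -⟪Φ.incl u, Φ.driftOn v⟫_ℝ := by
  refine Φ.denseRange_core.induction_on₂
    (p := fun u v => ⟪Φ.driftOn u, Φ.incl v⟫_ℝ = -⟪Φ.incl u, Φ.driftOn v⟫_ℝ)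
    (isClosed_eq (by fun_prop) (by fun_prop)) (fun f v => ?_) u v
  rw [Φ.driftOn_core, Φ.driftOn_core, Φ.incl_core, Φ.incl_core, Q.inner_drift]

/-- The squared norm of `V` on the core is the form plus `lam` times the ambient squared norm;
subtracting the latter isolates the form of the differences. -/
theorem isApprox_incl {f : ℕ → D} {x : V} (hf : Tendsto (fun n => Φ.core (f n)) atTop (𝓝 x)) :
    Q.IsApprox f (Φ.incl x) := by
  have hemb : Tendsto (fun n => Q.emb (f n)) atTop (𝓝 (Φ.incl x)) := by
    simpa [Function.comp_def, Φ.incl_core] using (Φ.incl.continuous.tendsto x).comp hf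
  refine ⟨hemb, ?_⟩
  have h1 : Tendsto (fun p : ℕ × ℕ => Φ.core (f p.1) - Φ.core (f p.2)) atTop (𝓝 (x - x)) := by
    rw [← prod_atTop_atTop_eq]
    exact (hf.comp tendsto_fst).sub (hf.comp tendsto_snd)
  have h2 : Tendsto (fun p : ℕ × ℕ => Q.emb (f p.1) - Q.emb (f p.2)) atTop
      (𝓝 (Φ.incl x - Φ.incl x)) := by
    rw [← prod_atTop_atTop_eq]
    exact (hemb.comp tendsto_fst).sub (hemb.comp tendsto_snd)
  have h3 := (h1.norm.pow 2).sub ((h2.norm.pow 2).const_mul lam)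
  simp only [sub_self, norm_zero, ne_eq, OfNat.ofNat_ne_zero, not_false_eq_true, zero_pow,
    mul_zero, ← map_sub, Φ.norm_core_sq, add_sub_cancel_right] at h3
  exact h3

theorem exists_tendsto_core (x : V) : ∃ f : ℕ → D, Tendsto (fun n => Φ.core (f n)) atTop (𝓝 x) := by
  obtain ⟨y, hy, hlim⟩ := mem_closure_iff_seq_limit.1 (Φ.denseRange_core x)
  choose f hf using hy
  exact ⟨f, by simpa [hf] using hlim⟩

theorem incl_mem_formDomain (x : V) : Φ.incl x ∈ Q.formDomain :=
  (Φ.exists_tendsto_core x).imp fun _ hf => Φ.isApprox_incl hf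

theorem incl_driftOn_mem_driftClosure (x : V) : (Φ.incl x, Φ.driftOn x) ∈ Q.driftClosure := by
  obtain ⟨f, hf⟩ := Φ.exists_tendsto_core x
  exact ⟨f, Φ.isApprox_incl hf, by
    simpa [Function.comp_def, Φ.driftOn_core] using (Φ.driftOn.continuous.tendsto x).comp hf⟩

/-- A core sequence converging in `V` competes in the infimum. The upper bound suffices, since the
closed form is only ever shown to tend to `0`. -/
theorem closedForm_incl_le (x : V) (hlam : 0 < lam) :
    Q.closedForm (Φ.incl x) ≤ ENNReal.ofReal (‖x‖ ^ 2) := by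
  obtain ⟨f, hf⟩ := Φ.exists_tendsto_core x
  refine (iInf₂_le f (Φ.isApprox_incl hf)).trans ?_
  have h : Tendsto (fun n => ENNReal.ofReal (‖Φ.core (f n)‖ ^ 2)) atTop
      (𝓝 (ENNReal.ofReal (‖x‖ ^ 2))) := ENNReal.tendsto_ofReal (hf.norm.pow 2)
  rw [← h.liminf_eq]
  refine liminf_le_liminf (Eventually.of_forall fun n => ENNReal.ofReal_le_ofReal ?_)
  rw [Φ.norm_core_sq]
  have : 0 ≤ lam * ‖Q.emb (f n)‖ ^ 2 := by positivity
  linarith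

/-- A form-Cauchy sequence that converges in `H` is Cauchy in `V`; completeness supplies the limit.
Thus every element of the form domain comes from `V`. -/
theorem exists_tendsto_of_isApprox [CompleteSpace V] {f : ℕ → D} {u : H} (hf : Q.IsApprox f u) :
    ∃ x, Tendsto (fun n => Φ.core (f n)) atTop (𝓝 x) ∧ Φ.incl x = u := by
  have hc : CauchySeq fun n => Φ.core (f n) := by
    rw [cauchySeq_iff_tendsto_dist_atTop_0]
    have h2 : Tendsto (fun p : ℕ × ℕ => Q.emb (f p.1) - Q.emb (f p.2)) atTop (𝓝 (u - u)) := by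
      rw [← prod_atTop_atTop_eq]
      exact (hf.1.comp tendsto_fst).sub (hf.1.comp tendsto_snd)
    have h3 := (hf.2.add ((h2.norm.pow 2).const_mul lam)).sqrt
    simp only [← map_sub, ← Φ.norm_core_sq, sub_self, norm_zero, ne_eq, OfNat.ofNat_ne_zero,
      not_false_eq_true, zero_pow, mul_zero, add_zero, Real.sqrt_zero,
      Real.sqrt_sq (norm_nonneg _)] at h3
    simpa only [dist_eq_norm, ← map_sub] using h3
  obtain ⟨x, hx⟩ := cauchySeq_tendsto_of_complete hc
  refine ⟨x, hx, tendsto_nhds_unique ?_ hf.1⟩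
  simpa [Function.comp_def, Φ.incl_core] using (Φ.incl.continuous.tendsto x).comp hx

end Realization

/-! ### Resolvents, their limits and the resolvent identity -/

section Resolvent

/-- The resolvents at `lam` exist, are uniformly bounded, and converge when the coupling constant
tends to infinity. -/
theorem exists_resolvent [CompleteSpace H] {lam : ℝ} (hlam : 0 < lam) :
    ∃ (R : ℝ → H →L[ℝ] H) (Rlim : H →L[ℝ] H) (K : ℝ),
      (∀ c, IsResolventAt (Q.sumGraph c) lam (R c)) ∧
      (∀ f, Tendsto (fun c => Q.closedForm (R c f - Rlim f) + ‖R c f - Rlim f‖ₑ ^ 2)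
        (comap (fun c : ℝ => |c|) atTop) (𝓝 0)) ∧
      (∀ f, Tendsto (fun c => R c f) (comap (fun c : ℝ => |c|) atTop) (𝓝 (Rlim f))) ∧
      (∀ c, ContinuousLinearMap.adjoint (R c) = R (-c)) ∧
      ∀ c f, ‖R c f‖ ≤ K * ‖f‖ := by
  obtain ⟨V, _, _, _, ⟨Φ⟩⟩ := Q.exists_realization hlam
  -- `J f` is the weak solution `u` of `(lam - A) u = f`.
  let J : H →L[ℝ] V := ContinuousLinearMap.adjoint Φ.incl
  have hJ : ∀ f x, ⟪J f, x⟫_ℝ = ⟪f, Φ.incl x⟫_ℝ := fun f x =>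
    ContinuousLinearMap.adjoint_inner_left _ _ _
  let S : V →L[ℝ] V := J.comp Φ.driftOn
  have hSJ : ∀ x y, ⟪S x, y⟫_ℝ = ⟪Φ.driftOn x, Φ.incl y⟫_ℝ := fun x y => hJ _ _
  have hS : ∀ x y, ⟪S x, y⟫_ℝ = -⟪x, S y⟫_ℝ := fun x y => by
    rw [hSJ, Φ.inner_driftOn, real_inner_comm (S y) x, hSJ, real_inner_comm]
  choose T hT hT' using exists_inverse_one_sub_smul hS
  obtain ⟨P, hP⟩ := tendsto_inverse_one_sub_smul hS T hT hT'
  have hbound : ∀ c h, ‖T c h‖ ≤ ‖h‖ := fun c h => by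
    simpa [hT] using norm_le_norm_sub_smul hS c (T c h)
  -- Write `h = (1 - c S) T c h` and `k = (1 + c S) T (-c) k` and move `S` across.
  have hTadj : ∀ c h k, ⟪T c h, k⟫_ℝ = ⟪h, T (-c) k⟫_ℝ := fun c h k => by
    conv_lhs => rw [← hT (-c) k]
    conv_rhs => rw [← hT c h]
    rw [inner_sub_left, inner_sub_right, real_inner_smul_left, real_inner_smul_right, hS]
    ring
  have hlim : ∀ f, Tendsto (fun c => Φ.incl (T c (J f))) (comap (fun c : ℝ => |c|) atTop)
      (𝓝 (Φ.incl (P (J f)))) := fun f => (Φ.incl.continuous.tendsto _).comp (hP (J f))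
  refine ⟨fun c => Φ.incl.comp ((T c).comp J), Φ.incl.comp (P.comp J), ‖Φ.incl‖ * ‖J‖,
    fun c => ⟨fun f => ?_, ?_⟩, fun f => ?_, hlim, fun c => ?_, fun c f => ?_⟩
  · set x := T c (J f) with hx
    -- The value of the generator is forced by the equation; that it belongs to the Friedrichs graph
    -- is `x - c • S x = J f` tested against the core.
    refine ⟨lam • Φ.incl x - f - c • Φ.driftOn x, Φ.driftOn x,
      ⟨Φ.incl_mem_formDomain x, fun v => ?_⟩, Φ.incl_driftOn_mem_driftClosure x, ?_⟩
    · have h1 : ⟪x, Φ.core v⟫_ℝ = ⟪c • S x + J f, Φ.core v⟫_ℝ := by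
        rw [← sub_eq_iff_eq_add'.1 (hT c (J f))]
      rw [Φ.inner_core_right, inner_add_left, real_inner_smul_left, hSJ, hJ, Φ.incl_core] at h1
      simp only [inner_sub_left, real_inner_smul_left]
      change ⟪Φ.incl x, Q.gen v⟫_ℝ = _
      linarith
    · simp [hx]
  -- The approximating sequence of the drift graph already realizes `u` in `V`, so the one from the
  -- form domain is dropped.
  · rintro ⟨u, w⟩ ⟨a, h, ⟨-, ha⟩, ⟨f, hf, hfh⟩, hw⟩
    obtain ⟨x, hx, hxu⟩ := Φ.exists_tendsto_of_isApprox hf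
    have hxh : Φ.driftOn x = h := by
      refine tendsto_nhds_unique ?_ hfh
      simpa [Function.comp_def, Φ.driftOn_core] using (Φ.driftOn.continuous.tendsto x).comp hx
    simp only at ha hxu hw ⊢
    have hkey : x - c • S x = J (lam • u - w) := by
      refine Φ.denseRange_core.eq_of_inner_left ℝ fun v => ?_
      rw [inner_sub_left, real_inner_smul_left, hSJ, hJ, Φ.inner_core_right, Φ.incl_core, hxu,
        ha, hxh, hw]
      simp only [inner_sub_left, inner_add_left, real_inner_smul_left]
      ring
    simp only [ContinuousLinearMap.comp_apply]
    rw [← hkey, hT', hxu]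
  · have h0 : Tendsto (fun c => T c (J f) - P (J f)) (comap (fun c : ℝ => |c|) atTop) (𝓝 0) := by
      simpa using (hP (J f)).sub_const (P (J f))
    have h1 : Tendsto (fun c => ENNReal.ofReal (‖T c (J f) - P (J f)‖ ^ 2))
        (comap (fun c : ℝ => |c|) atTop) (𝓝 0) := by
      simpa using ENNReal.tendsto_ofReal (h0.norm.pow 2)
    have h2 : Tendsto (fun c => ‖Φ.incl (T c (J f)) - Φ.incl (P (J f))‖ₑ ^ 2)
        (comap (fun c : ℝ => |c|) atTop) (𝓝 0) := by
      have := ((hlim f).sub_const (Φ.incl (P (J f)))).enorm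
      simpa using ENNReal.Tendsto.pow (n := 2) this
    have h3 := h1.add h2
    rw [add_zero] at h3
    refine tendsto_of_tendsto_of_tendsto_of_le_of_le tendsto_const_nhds h3 (fun _ => zero_le)
      fun c => ?_
    simp only [ContinuousLinearMap.comp_apply, ← map_sub]
    gcongr
    exact Φ.closedForm_incl_le _ hlam
  · symm
    rw [ContinuousLinearMap.eq_adjoint_iff]
    intro f k
    simp only [ContinuousLinearMap.comp_apply]
    rw [real_inner_comm, ← hJ, ← hTadj, real_inner_comm, hJ]
  · simp only [ContinuousLinearMap.comp_apply]
    calc _ ≤ ‖Φ.incl‖ * ‖T c (J f)‖ := Φ.incl.le_opNorm _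
      _ ≤ ‖Φ.incl‖ * (‖J‖ * ‖f‖) := by
        gcongr
        exact (hbound _ _).trans (J.le_opNorm _)
      _ = _ := by ring

/-- Since `R' f` lies in the domain of the common operator `T`, `R` can be applied to `(lam - T) R'
f = f - (mu - lam) • R' f`. -/
theorem resolvent_sub {lam mu : ℝ} {Γ : Set (H × H)} {R R' : H →L[ℝ] H}
    (hR : IsResolventAt Γ lam R) (hR' : IsResolventAt Γ mu R') (f : H) :
    (mu - lam) • R (R' f) = R f - R' f := by
  have h := hR.2 _ (hR'.1 f)
  simp only at h
  rw [show lam • R' f - (mu • R' f - f) = f - (mu - lam) • R' f by rw [sub_smul]; abel, map_sub,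
    map_smul, sub_eq_iff_eq_add] at h
  rw [h]; abel

theorem resolvent_of_mem {lam : ℝ} (hlam : 0 < lam) {Γ : Set (H × H)} {R : H →L[ℝ] H}
    (hR : IsResolventAt Γ lam R) {u : H} (hu : (u, 0) ∈ Γ) : R u = lam⁻¹ • u := by
  have h := hR.2 _ hu
  simp only [sub_zero, map_smul] at h
  rw [eq_inv_smul_iff₀ hlam.ne', h]

/-- The constant sequence `e` approximates `Q.emb e`, and the form bound forces the drift of `e` to
vanish. On the manifold `e` is the constant function `1`. -/
theorem emb_mem_sumGraph {e : D} (he : ∀ v, Q.form e v = 0) (c : ℝ) :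
    (Q.emb e, 0) ∈ Q.sumGraph c := by
  have ha : Q.IsApprox (fun _ => e) (Q.emb e) := ⟨tendsto_const_nhds, by simp⟩
  have hd : Q.drift e = 0 := by
    have := Q.norm_drift_sq_le e
    rw [he, mul_zero] at this
    simpa using le_antisymm this (sq_nonneg _)
  refine ⟨0, 0, ⟨⟨_, ha⟩, fun v => ?_⟩, ⟨_, ha, by simp [hd]⟩, by simp⟩
  have := Q.form_eq e v
  rw [he] at this
  simp only [inner_zero_left]
  linarith

/-- The homogenization theorem for symmetric forms with an antisymmetric drift. -/
theorem exists_resolvent_family [CompleteSpace H] {e : D} (he : ∀ v, Q.form e v = 0) :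
    ∃ (Rc : ℝ → ℝ → H →L[ℝ] H) (Rlim : ℝ → H →L[ℝ] H),
      (∀ c lam : ℝ, 0 < lam → IsResolventAt (Q.sumGraph c) lam (Rc c lam)) ∧
      (∀ lam : ℝ, 0 < lam → ∀ f : H,
        Tendsto (fun c : ℝ => Q.closedForm (Rc c lam f - Rlim lam f) +
          ‖Rc c lam f - Rlim lam f‖ₑ ^ 2) (comap (fun c : ℝ => |c|) atTop) (𝓝 0)) ∧
      (∀ lam mu : ℝ, 0 < lam → 0 < mu →
        (mu - lam) • (Rlim lam ∘L Rlim mu) = Rlim lam - Rlim mu) ∧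
      (∀ c lam : ℝ, 0 < lam → ContinuousLinearMap.adjoint (Rc c lam) = Rc (-c) lam) ∧
      (∀ lam : ℝ, 0 < lam → IsSelfAdjoint (Rlim lam)) ∧
      (∀ lam : ℝ, 0 < lam → ∀ f : H, ⟪Q.emb e, f⟫_ℝ = 0 →
        (∀ c : ℝ, ⟪Q.emb e, Rc c lam f⟫_ℝ = 0) ∧ ⟪Q.emb e, Rlim lam f⟫_ℝ = 0) := by
  -- Positivity of `lam` is placed inside the existential so that `choose` yields families indexed
  -- by all reals; for `lam ≤ 0` they are zero.
  have hex : ∀ lam : ℝ, ∃ (R : ℝ → H →L[ℝ] H) (Rlim : H →L[ℝ] H) (K : ℝ), 0 < lam →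
      (∀ c, IsResolventAt (Q.sumGraph c) lam (R c)) ∧
      (∀ f, Tendsto (fun c => Q.closedForm (R c f - Rlim f) + ‖R c f - Rlim f‖ₑ ^ 2)
        (comap (fun c : ℝ => |c|) atTop) (𝓝 0)) ∧
      (∀ f, Tendsto (fun c => R c f) (comap (fun c : ℝ => |c|) atTop) (𝓝 (Rlim f))) ∧
      (∀ c, ContinuousLinearMap.adjoint (R c) = R (-c)) ∧
      ∀ c f, ‖R c f‖ ≤ K * ‖f‖ := by
    intro lam
    by_cases hlam : 0 < lam
    · obtain ⟨R, Rlim, K, h⟩ := Q.exists_resolvent hlam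
      exact ⟨R, Rlim, K, fun _ => h⟩
    · exact ⟨0, 0, 0, fun h => absurd h hlam⟩
  choose R Rlim K hres using hex
  have hne : (comap (fun c : ℝ => |c|) atTop).NeBot := by
    refine comap_neBot fun s hs => ?_
    obtain ⟨a, ha⟩ := mem_atTop_sets.1 hs
    exact ⟨|a|, ha _ (by simpa using le_abs_self a)⟩
  have hneg : Tendsto (fun c : ℝ => -c) (comap (fun c : ℝ => |c|) atTop)
      (comap (fun c : ℝ => |c|) atTop) := by
    rw [tendsto_comap_iff]
    simpa [Function.comp_def] using
      (tendsto_comap : Tendsto (fun c : ℝ => |c|) (comap (fun c : ℝ => |c|) atTop) atTop)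
  -- Move the resolvent onto `Q.emb e`, where its adjoint, the resolvent for `-c`, acts as
  -- multiplication by `lam⁻¹`.
  have hmean : ∀ lam : ℝ, 0 < lam → ∀ f : H, ⟪Q.emb e, f⟫_ℝ = 0 →
      ∀ c : ℝ, ⟪Q.emb e, R lam c f⟫_ℝ = 0 := fun lam hlam f hf c => by
    rw [← ContinuousLinearMap.adjoint_inner_left, (hres lam hlam).2.2.2.1,
      resolvent_of_mem hlam ((hres lam hlam).1 _) (Q.emb_mem_sumGraph he _), real_inner_smul_left,
      hf, mul_zero]
  refine ⟨fun c lam => R lam c, Rlim, fun c lam h => (hres lam h).1 c,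
    fun lam h => (hres lam h).2.1, fun lam mu hl hm => ?_, fun c lam h => (hres lam h).2.2.2.1 c,
    fun lam hl => ?_, fun lam hl f hf => ⟨hmean lam hl f hf, ?_⟩⟩
  · ext1 f
    have h1 := (hres lam hl).2.2.1 f
    have h2 := (hres mu hm).2.2.1 f
    have h3 : Tendsto (fun c => R lam c (R mu c f)) (comap (fun c : ℝ => |c|) atTop)
        (𝓝 (Rlim lam (Rlim mu f))) := by
      -- Products of strongly convergent families converge strongly because `K lam` bounds `R lam c`
      -- uniformly in `c`.
      have h4 : Tendsto (fun c => R lam c (R mu c f - Rlim mu f))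
          (comap (fun c : ℝ => |c|) atTop) (𝓝 0) := by
        refine squeeze_zero_norm (fun c => (hres lam hl).2.2.2.2 c _) ?_
        simpa using ((h2.sub_const (Rlim mu f)).norm).const_mul (K lam)
      simpa using h4.add ((hres lam hl).2.2.1 (Rlim mu f))
    refine tendsto_nhds_unique (h3.const_smul (mu - lam)) ?_
    exact (h1.sub h2).congr fun c => (resolvent_sub ((hres lam hl).1 c) ((hres mu hm).1 c) f).symm
  · rw [ContinuousLinearMap.isSelfAdjoint_iff_isSymmetric]
    intro f k
    have h1 := ((hres lam hl).2.2.1 f).inner (𝕜 := ℝ) (tendsto_const_nhds (x := k))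
    have h2 := (tendsto_const_nhds (x := f)).inner (𝕜 := ℝ) (((hres lam hl).2.2.1 k).comp hneg)
    refine tendsto_nhds_unique h1 (h2.congr fun c => ?_)
    rw [Function.comp_apply, ← (hres lam hl).2.2.2.1, ContinuousLinearMap.adjoint_inner_right]
  · have h1 := (tendsto_const_nhds (x := Q.emb e)).inner (𝕜 := ℝ) ((hres lam hl).2.2.1 f)
    refine tendsto_nhds_unique h1 ?_
    simp [hmean lam hl f hf]

end Resolvent

end DriftForm

end Abstract

variable {d : ℕ} {M : Type*} [TopologicalSpace M]
  [ChartedSpace (EuclideanSpace ℝ (Fin d)) M] [IsManifold (𝓡 d) ∞ M]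

/-! ### Calculus in charts

Tangent spaces are identified with the model space, which allows one to compare tangent vectors at
points which are only propositionally equal. -/

/-- The derivative of a chart, as an endomorphism of the model space. -/
def chartDeriv (e : OpenPartialHomeomorph M (EuclideanSpace ℝ (Fin d))) (x : M) : (EuclideanSpace ℝ (Fin d)) →L[ℝ] EuclideanSpace ℝ (Fin d) :=
  mfderiv (𝓡 d) 𝓘(ℝ, EuclideanSpace ℝ (Fin d)) e x

/-- The derivative of the inverse of a chart, as an endomorphism of the model space. -/
def chartSymmDeriv (e : OpenPartialHomeomorph M (EuclideanSpace ℝ (Fin d))) (y : EuclideanSpace ℝ (Fin d)) : (EuclideanSpace ℝ (Fin d)) →L[ℝ] EuclideanSpace ℝ (Fin d) :=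
  mfderiv 𝓘(ℝ, EuclideanSpace ℝ (Fin d)) (𝓡 d) e.symm y

/-- The metric as a bilinear form on the model space. -/
def modelInner (g : Metric d M) (x : M) (v w : EuclideanSpace ℝ (Fin d)) : ℝ :=
  g.inner x (v : TangentSpace (𝓡 d) x) (w : TangentSpace (𝓡 d) x)

theorem gramMatrix_apply (g : Metric d M) (e : OpenPartialHomeomorph M (EuclideanSpace ℝ (Fin d))) (y : EuclideanSpace ℝ (Fin d)) (j k : Fin d) :
    gramMatrix g e y j k = modelInner g (e.symm y)
      (chartSymmDeriv e y (EuclideanSpace.single j 1))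
      (chartSymmDeriv e y (EuclideanSpace.single k 1)) := rfl

theorem component_eq (e : OpenPartialHomeomorph M (EuclideanSpace ℝ (Fin d))) (X : ∀ x : M, TangentSpace (𝓡 d) x)
    (j : Fin d) (y : EuclideanSpace ℝ (Fin d)) :
    component e X j y = (chartDeriv e (e.symm y) (X (e.symm y))) j := rfl

section Chart

variable {e : OpenPartialHomeomorph M (EuclideanSpace ℝ (Fin d))}

theorem chartSymmDeriv_comp_chartDeriv (he : e ∈ atlas (EuclideanSpace ℝ (Fin d)) M) {x : M} (hx : x ∈ e.source) (v : EuclideanSpace ℝ (Fin d)) :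
    chartSymmDeriv e (e x) (chartDeriv e x v) = v := by
  have h := (mdifferentiable_of_mem_atlas (I := 𝓡 d) he).symm_comp_deriv hx
  exact DFunLike.congr_fun h v

theorem chartDeriv_comp_chartSymmDeriv (he : e ∈ atlas (EuclideanSpace ℝ (Fin d)) M) {y : (EuclideanSpace ℝ (Fin d))} (hy : y ∈ e.target) (v : EuclideanSpace ℝ (Fin d)) :
    chartDeriv e (e.symm y) (chartSymmDeriv e y v) = v := by
  have h := (mdifferentiable_of_mem_atlas (I := 𝓡 d) he).comp_symm_deriv hy
  exact DFunLike.congr_fun h v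

theorem chartSymmDeriv_chartDeriv (he : e ∈ atlas (EuclideanSpace ℝ (Fin d)) M) {y : (EuclideanSpace ℝ (Fin d))} (hy : y ∈ e.target) (v : EuclideanSpace ℝ (Fin d)) :
    chartSymmDeriv e y (chartDeriv e (e.symm y) v) = v := by
  have h := chartSymmDeriv_comp_chartDeriv he (e.map_target hy) v
  rwa [e.right_inv hy] at h

theorem mvfderiv_chartSymmDeriv (he : e ∈ atlas (EuclideanSpace ℝ (Fin d)) M) {y : (EuclideanSpace ℝ (Fin d))} (hy : y ∈ e.target) {f : M → ℝ}
    (hf : MDifferentiableAt (𝓡 d) 𝓘(ℝ, ℝ) f (e.symm y)) (v : EuclideanSpace ℝ (Fin d)) :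
    mvfderiv (𝓡 d) f (e.symm y) (chartSymmDeriv e y v) = fderiv ℝ (f ∘ e.symm) y v := by
  have hs := (mdifferentiable_of_mem_atlas (I := 𝓡 d) he).mdifferentiableAt_symm hy
  have h := mfderiv_comp y hf hs
  rw [mfderiv_eq_fderiv] at h
  rw [h]
  rfl

/-- The derivative of a function along a vector field in coordinates. -/
theorem mvfderiv_eq_sum (he : e ∈ atlas (EuclideanSpace ℝ (Fin d)) M) {y : (EuclideanSpace ℝ (Fin d))} (hy : y ∈ e.target) {f : M → ℝ}
    (hf : MDifferentiableAt (𝓡 d) 𝓘(ℝ, ℝ) f (e.symm y)) (X : ∀ x : M, TangentSpace (𝓡 d) x) :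
    mvfderiv (𝓡 d) f (e.symm y) (X (e.symm y)) =
      ∑ j, component e X j y * fderiv ℝ (f ∘ e.symm) y (EuclideanSpace.single j 1) := by
  have h1 : (X (e.symm y) : EuclideanSpace ℝ (Fin d)) = chartSymmDeriv e y (chartDeriv e (e.symm y) (X (e.symm y))) :=
    (chartSymmDeriv_chartDeriv he hy _).symm
  have h2 := mvfderiv_chartSymmDeriv he hy hf (chartDeriv e (e.symm y) (X (e.symm y)))
  rw [← h1] at h2
  refine h2.trans ?_
  conv_lhs => rw [← (EuclideanSpace.basisFun (Fin d) ℝ).sum_repr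
    (chartDeriv e (e.symm y) (X (e.symm y)))]
  simp [map_sum, component_eq]

theorem modelInner_sum (g : Metric d M) (x : M) {ι : Type*} (s : Finset ι) (v : ι → (EuclideanSpace ℝ (Fin d))) (w : EuclideanSpace ℝ (Fin d)) :
    modelInner g x (∑ i ∈ s, v i) w = ∑ i ∈ s, modelInner g x (v i) w := by
  have h : ∀ v, modelInner g x v w =
    ((g.inner x : (EuclideanSpace ℝ (Fin d)) →L[ℝ] EuclideanSpace ℝ (Fin d) →L[ℝ] ℝ).flip w) v := fun v => rfl
  simp only [h, map_sum]

theorem modelInner_smul (g : Metric d M) (x : M) (c : ℝ) (v w : EuclideanSpace ℝ (Fin d)) :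
    modelInner g x (c • v) w = c * modelInner g x v w := by
  have h : ∀ v, modelInner g x v w =
    ((g.inner x : (EuclideanSpace ℝ (Fin d)) →L[ℝ] EuclideanSpace ℝ (Fin d) →L[ℝ] ℝ).flip w) v := fun v => rfl
  simp only [h, map_smul, smul_eq_mul]

theorem modelInner_comm (g : Metric d M) (x : M) (v w : EuclideanSpace ℝ (Fin d)) :
    modelInner g x v w = modelInner g x w v := g.symm x v w

/-- The metric of the images of coordinate vectors, in terms of the Gram matrix. -/
theorem modelInner_chartSymmDeriv (g : Metric d M) (y v w : EuclideanSpace ℝ (Fin d)) :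
    modelInner g (e.symm y) (chartSymmDeriv e y v) (chartSymmDeriv e y w) =
      v.ofLp ⬝ᵥ (gramMatrix g e y).mulVec w.ofLp := by
  have hv : ∀ v : EuclideanSpace ℝ (Fin d), chartSymmDeriv e y v =
      ∑ j, v j • chartSymmDeriv e y (EuclideanSpace.single j 1) := fun v => by
    conv_lhs => rw [← (EuclideanSpace.basisFun (Fin d) ℝ).sum_repr v]
    simp [map_sum]
  rw [hv v, modelInner_sum]
  simp only [modelInner_smul, dotProduct, Matrix.mulVec]
  refine Finset.sum_congr rfl fun j _ => ?_
  rw [modelInner_comm, hv w, modelInner_sum]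
  congr 1
  refine Finset.sum_congr rfl fun k _ => ?_
  rw [modelInner_smul, modelInner_comm, gramMatrix_apply, mul_comm]

/-- The quadratic form of the Gram matrix is the squared length of the image under the derivative of
`e.symm`, which is injective. -/
theorem gramMatrix_posDef (g : Metric d M) (he : e ∈ atlas (EuclideanSpace ℝ (Fin d)) M) {y : (EuclideanSpace ℝ (Fin d))} (hy : y ∈ e.target) :
    (gramMatrix g e y).PosDef := by
  refine Matrix.PosDef.of_dotProduct_mulVec_pos ?_ fun v hv => ?_
  · ext j k
    simp [gramMatrix_apply, modelInner_comm]
  · have h := modelInner_chartSymmDeriv (e := e) g y (WithLp.toLp 2 v) (WithLp.toLp 2 v)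
    simp only [star_trivial] at h ⊢
    rw [← h]
    refine g.pos _ _ fun h0 => hv ?_
    have h1 := chartDeriv_comp_chartSymmDeriv he hy (WithLp.toLp 2 v)
    have h0' : chartSymmDeriv e y (WithLp.toLp 2 v) = 0 := h0
    rw [h0', map_zero] at h1
    simpa using h1.symm

theorem sqrtDet_pos (g : Metric d M) (he : e ∈ atlas (EuclideanSpace ℝ (Fin d)) M) {y : (EuclideanSpace ℝ (Fin d))} (hy : y ∈ e.target) :
    0 < sqrtDet g e y :=
  Real.sqrt_pos.2 (gramMatrix_posDef g he hy).det_pos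

theorem contMDiffOn_symm_of_mem_atlas (he : e ∈ atlas (EuclideanSpace ℝ (Fin d)) M) :
    ContMDiffOn 𝓘(ℝ, EuclideanSpace ℝ (Fin d)) (𝓡 d) ∞ e.symm e.target :=
  contMDiffOn_symm_of_mem_maximalAtlas (IsManifold.subset_maximalAtlas he)

theorem contMDiffOn_of_mem_atlas (he : e ∈ atlas (EuclideanSpace ℝ (Fin d)) M) :
    ContMDiffOn (𝓡 d) 𝓘(ℝ, EuclideanSpace ℝ (Fin d)) ∞ e e.source :=
  contMDiffOn_of_mem_maximalAtlas (IsManifold.subset_maximalAtlas he)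

/-- The coordinate field is the tangent map of `e.symm` applied to a constant vector field. -/
theorem contMDiffOn_coordField (he : e ∈ atlas (EuclideanSpace ℝ (Fin d)) M) (j : Fin d) :
    ContMDiffOn 𝓘(ℝ, EuclideanSpace ℝ (Fin d)) (𝓡 d).tangent ∞
      (fun y => (⟨e.symm y, coordField e j y⟩ : TangentBundle (𝓡 d) M)) e.target := by
  have h1 := (contMDiffOn_symm_of_mem_atlas he).contMDiffOn_tangentMapWithin (m := ∞)
    (by simp) e.open_target.uniqueMDiffOn
  have h2 := (contMDiffOn_vectorSpace_iff_contDiffOn (𝕜 := ℝ) (n := ∞) (s := e.target)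
    (V := fun y : EuclideanSpace ℝ (Fin d) => EuclideanSpace.single j (1 : ℝ))).2 contDiffOn_const
  refine (h1.comp h2 fun y hy => by simpa using hy).congr fun y hy => ?_
  simp only [Function.comp_apply, tangentMapWithin]
  rw [mfderivWithin_of_isOpen e.open_target hy]
  rfl

theorem contDiffOn_gramMatrix (g : Metric d M) (he : e ∈ atlas (EuclideanSpace ℝ (Fin d)) M) (j k : Fin d) :
    ContDiffOn ℝ ∞ (fun y => gramMatrix g e y j k) e.target := by
  rw [← contMDiffOn_iff_contDiffOn]
  intro y hy
  have h : ContMDiffWithinAt 𝓘(ℝ, EuclideanSpace ℝ (Fin d)) ((𝓡 d).prod 𝓘(ℝ)) ∞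
      (fun m => Bundle.TotalSpace.mk' ℝ (E := Bundle.Trivial M ℝ) (e.symm m)
        (g.inner (e.symm m) (coordField e j m) (coordField e k m))) e.target y := by
    apply ContMDiffWithinAt.clm_bundle_apply₂ (F₁ := (EuclideanSpace ℝ (Fin d))) (F₂ := (EuclideanSpace ℝ (Fin d)))
    · exact ContMDiffAt.comp_contMDiffWithinAt y g.contMDiff.contMDiffAt
        (contMDiffOn_symm_of_mem_atlas he y hy)
    · exact contMDiffOn_coordField he j y hy
    · exact contMDiffOn_coordField he k y hy
  simp only [Bundle.contMDiffWithinAt_totalSpace] at h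
  exact h.2

end Chart

/-! ### Regularity of the density, of components and of gradients in charts -/

section ChartSmooth

variable {e : OpenPartialHomeomorph M (EuclideanSpace ℝ (Fin d))}

theorem contDiffOn_det {E ι : Type*} [NormedAddCommGroup E] [NormedSpace ℝ E] [Fintype ι]
    [DecidableEq ι] {n : WithTop ℕ∞} {s : Set E} {A : E → Matrix ι ι ℝ}
    (hA : ∀ j k, ContDiffOn ℝ n (fun y => A y j k) s) : ContDiffOn ℝ n (fun y => (A y).det) s := by
  simp only [Matrix.det_apply']
  refine ContDiffOn.sum fun σ _ => contDiffOn_const.mul ?_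
  exact contDiffOn_prod fun i _ => hA _ _

/-- Cramer's rule: entries of the inverse are quotients of determinants, hence as regular as the
matrix. -/
theorem contDiffOn_inv_mulVec {E ι : Type*} [NormedAddCommGroup E] [NormedSpace ℝ E] [Fintype ι]
    [DecidableEq ι] {n : WithTop ℕ∞} {s : Set E} {A : E → Matrix ι ι ℝ} {v : E → ι → ℝ}
    (hA : ∀ j k, ContDiffOn ℝ n (fun y => A y j k) s) (hv : ∀ j, ContDiffOn ℝ n (fun y => v y j) s)
    (hdet : ∀ y ∈ s, (A y).det ≠ 0) (j : ι) :
    ContDiffOn ℝ n (fun y => ((A y)⁻¹.mulVec (v y)) j) s := by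
  simp only [Matrix.mulVec, dotProduct, Matrix.inv_def, Matrix.smul_apply, smul_eq_mul,
    Ring.inverse_eq_inv', Matrix.adjugate_apply]
  refine ContDiffOn.sum fun k _ => ((contDiffOn_det hA).inv hdet |>.mul ?_).mul (hv k)
  refine contDiffOn_det fun a b => ?_
  by_cases hab : a = k
  · subst hab
    simp only [Matrix.updateRow_self]
    exact contDiffOn_const
  · simp only [Matrix.updateRow_ne hab]
    exact hA a b

theorem contDiffOn_sqrtDet (g : Metric d M) (he : e ∈ atlas (EuclideanSpace ℝ (Fin d)) M) :
    ContDiffOn ℝ ∞ (sqrtDet g e) e.target :=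
  (contDiffOn_det (contDiffOn_gramMatrix g he)).sqrt fun _ hy =>
    (gramMatrix_posDef g he hy).det_pos.ne'

/-- The components of a vector field of class `C^1` are of class `C^1`. -/
theorem contDiffOn_component (he : e ∈ atlas (EuclideanSpace ℝ (Fin d)) M)
    {X : ∀ x : M, TangentSpace (𝓡 d) x}
    (hX : ContMDiff (𝓡 d) (𝓡 d).tangent 1 (fun x => (⟨x, X x⟩ : TangentBundle (𝓡 d) M)))
    (j : Fin d) : ContDiffOn ℝ 1 (component e X j) e.target := by
  have h1 := (contMDiffOn_of_mem_atlas he).contMDiffOn_tangentMapWithin (m := 1)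
    (by norm_cast) e.open_source.uniqueMDiffOn
  have h2 : ContMDiffOn 𝓘(ℝ, EuclideanSpace ℝ (Fin d)) (𝓡 d).tangent 1
      (fun y => (⟨e.symm y, X (e.symm y)⟩ : TangentBundle (𝓡 d) M)) e.target :=
    hX.comp_contMDiffOn ((contMDiffOn_symm_of_mem_atlas he).of_le (by norm_cast))
  have h3 := h1.comp h2 fun y hy => by simpa using e.map_target hy
  have h4 := (contMDiffOn_vectorSpace_iff_contDiffOn (𝕜 := ℝ) (n := 1) (s := e.target)
    (V := fun y : EuclideanSpace ℝ (Fin d) => chartDeriv e (e.symm y) (X (e.symm y)))).1 (by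
      refine h3.congr fun y hy => ?_
      simp only [Function.comp_apply, tangentMapWithin]
      rw [mfderivWithin_of_isOpen e.open_source (e.map_target hy), e.right_inv hy]
      rfl)
  exact (contDiffOn_euclidean.1 h4) j

theorem contDiffOn_comp_symm (he : e ∈ atlas (EuclideanSpace ℝ (Fin d)) M) {n : WithTop ℕ∞}
    (hn : n ≤ (∞ : WithTop ℕ∞)) {f : M → ℝ} (hf : ContMDiff (𝓡 d) 𝓘(ℝ, ℝ) n f) :
    ContDiffOn ℝ n (f ∘ e.symm) e.target :=
  contMDiffOn_iff_contDiffOn.1 (hf.comp_contMDiffOn ((contMDiffOn_symm_of_mem_atlas he).of_le hn))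

theorem contDiffOn_fderiv_comp_symm (he : e ∈ atlas (EuclideanSpace ℝ (Fin d)) M)
    {m n : WithTop ℕ∞} (hn : n ≤ (∞ : WithTop ℕ∞)) (hmn : m + 1 ≤ n) {f : M → ℝ}
    (hf : ContMDiff (𝓡 d) 𝓘(ℝ, ℝ) n f) (v : EuclideanSpace ℝ (Fin d)) :
    ContDiffOn ℝ m (fun y => fderiv ℝ (f ∘ e.symm) y v) e.target :=
  ((contDiffOn_comp_symm he hn hf).fderiv_of_isOpen e.open_target hmn).clm_apply contDiffOn_const

/-- The components of the gradient. -/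
theorem component_grad (g : Metric d M) (he : e ∈ atlas (EuclideanSpace ℝ (Fin d)) M) {f : M → ℝ}
    {y : EuclideanSpace ℝ (Fin d)} (hy : y ∈ e.target)
    (hf : MDifferentiableAt (𝓡 d) 𝓘(ℝ, ℝ) f (e.symm y)) (j : Fin d) :
    component e (grad g f) j y = ((gramMatrix g e y)⁻¹.mulVec
      fun k => fderiv ℝ (f ∘ e.symm) y (EuclideanSpace.single k 1)) j := by
  have hdet : IsUnit (gramMatrix g e y).det := (gramMatrix_posDef g he hy).det_pos.ne'.isUnit
  -- The defining relation of the gradient, tested on coordinate fields, is a linear system with the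
  -- Gram matrix as coefficients.
  have key : (gramMatrix g e y).mulVec (fun k => component e (grad g f) k y) =
      fun k => fderiv ℝ (f ∘ e.symm) y (EuclideanSpace.single k 1) := by
    ext k
    rw [← mvfderiv_chartSymmDeriv he hy hf]
    let w : EuclideanSpace ℝ (Fin d) := grad g f (e.symm y)
    have h1 : mvfderiv (𝓡 d) f (e.symm y) (chartSymmDeriv e y (EuclideanSpace.single k 1)) =
        modelInner g (e.symm y) w
          (chartSymmDeriv e y (EuclideanSpace.single k 1)) := (inner_grad g f _ _).symm
    have h2 := modelInner_chartSymmDeriv (e := e) g y (EuclideanSpace.single k 1)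
      (chartDeriv e (e.symm y) w)
    rw [chartSymmDeriv_chartDeriv he hy] at h2
    rw [h1, modelInner_comm, h2]
    simp only [PiLp.ofLp_single, single_one_dotProduct]
    rfl
  rw [← key, Matrix.mulVec_mulVec, Matrix.nonsing_inv_mul _ hdet, Matrix.one_mulVec]

theorem contDiffOn_component_grad (g : Metric d M)
    (he : e ∈ atlas (EuclideanSpace ℝ (Fin d)) M) {f : M → ℝ}
    (hf : ContMDiff (𝓡 d) 𝓘(ℝ, ℝ) ∞ f) (j : Fin d) :
    ContDiffOn ℝ ∞ (component e (grad g f) j) e.target := by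
  refine (contDiffOn_inv_mulVec (contDiffOn_gramMatrix g he)
    (fun k => contDiffOn_fderiv_comp_symm he le_rfl (by simp) hf (EuclideanSpace.single k 1))
    (fun y hy => (gramMatrix_posDef g he hy).det_pos.ne') j).congr fun y hy => ?_
  exact component_grad g he hy (hf.mdifferentiableAt (by simp)) j

end ChartSmooth

/-! ### Change of charts -/

section ChangeOfChart

variable {e e' : OpenPartialHomeomorph M (EuclideanSpace ℝ (Fin d))}

theorem differentiableAt_transition (he : e ∈ atlas (EuclideanSpace ℝ (Fin d)) M)
    (he' : e' ∈ atlas (EuclideanSpace ℝ (Fin d)) M) {y : EuclideanSpace ℝ (Fin d)}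
    (hy : y ∈ e.target) (hy' : e.symm y ∈ e'.source) :
    DifferentiableAt ℝ (e' ∘ e.symm) y := by
  rw [← mdifferentiableAt_iff_differentiableAt]
  exact ((mdifferentiable_of_mem_atlas (I := 𝓡 d) he').mdifferentiableAt hy').comp y
    ((mdifferentiable_of_mem_atlas (I := 𝓡 d) he).mdifferentiableAt_symm hy)

theorem chartSymmDeriv_eq_comp (he : e ∈ atlas (EuclideanSpace ℝ (Fin d)) M)
    (he' : e' ∈ atlas (EuclideanSpace ℝ (Fin d)) M) {y : EuclideanSpace ℝ (Fin d)}
    (hy : y ∈ e.target) (hy' : e.symm y ∈ e'.source) (v : EuclideanSpace ℝ (Fin d)) :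
    chartSymmDeriv e y v = chartSymmDeriv e' (e' (e.symm y)) (fderiv ℝ (e' ∘ e.symm) y v) := by
  have h := mfderiv_comp y ((mdifferentiable_of_mem_atlas (I := 𝓡 d) he').mdifferentiableAt hy')
    ((mdifferentiable_of_mem_atlas (I := 𝓡 d) he).mdifferentiableAt_symm hy)
  have h' : fderiv ℝ (e' ∘ e.symm) y v = chartDeriv e' (e.symm y) (chartSymmDeriv e y v) := by
    rw [← mfderiv_eq_fderiv]
    exact DFunLike.congr_fun h v
  rw [h', chartSymmDeriv_comp_chartDeriv he' hy']

/-- The transformation of the density `√g` under a change of charts. -/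
theorem sqrtDet_eq_abs_det_mul (g : Metric d M) (he : e ∈ atlas (EuclideanSpace ℝ (Fin d)) M)
    (he' : e' ∈ atlas (EuclideanSpace ℝ (Fin d)) M) {y : EuclideanSpace ℝ (Fin d)}
    (hy : y ∈ e.target) (hy' : e.symm y ∈ e'.source) :
    sqrtDet g e y = |(fderiv ℝ (e' ∘ e.symm) y).det| * sqrtDet g e' (e' (e.symm y)) := by
  let L := fderiv ℝ (e' ∘ e.symm) y
  let A : Matrix (Fin d) (Fin d) ℝ := Matrix.of fun i j => L (EuclideanSpace.single j 1) i
  -- The Gram matrix transforms as a bilinear form under the Jacobian `A` of the transition map.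
  have hgram : gramMatrix g e y = A.transpose * gramMatrix g e' (e' (e.symm y)) * A := by
    ext j k
    have h := modelInner_chartSymmDeriv (e := e') g (e' (e.symm y))
      (L (EuclideanSpace.single j 1)) (L (EuclideanSpace.single k 1))
    rw [gramMatrix_apply, chartSymmDeriv_eq_comp he he' hy hy', chartSymmDeriv_eq_comp he he' hy hy']
    rw [e'.left_inv hy'] at h
    rw [h, Matrix.mul_assoc, Matrix.mul_apply]
    rfl
  have hdet : A.det = L.det := by
    have : A = LinearMap.toMatrix (EuclideanSpace.basisFun (Fin d) ℝ).toBasis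
        (EuclideanSpace.basisFun (Fin d) ℝ).toBasis (L : EuclideanSpace ℝ (Fin d) →ₗ[ℝ] _) := by
      ext i j
      simp [A, LinearMap.toMatrix_apply]
    rw [this, LinearMap.det_toMatrix]
  rw [sqrtDet, hgram, Matrix.det_mul, Matrix.det_mul, Matrix.det_transpose, hdet,
    show L.det * (gramMatrix g e' (e' (e.symm y))).det * L.det =
      L.det ^ 2 * (gramMatrix g e' (e' (e.symm y))).det by ring,
    Real.sqrt_mul (sq_nonneg _), Real.sqrt_sq_eq_abs]
  rfl

end ChangeOfChart

/-! ### The Riemannian volume in charts -/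

section Volume

variable {e e' : OpenPartialHomeomorph M (EuclideanSpace ℝ (Fin d))} [MeasurableSpace M]
  [BorelSpace M]

theorem aemeasurable_symm (e : OpenPartialHomeomorph M (EuclideanSpace ℝ (Fin d))) :
    AEMeasurable e.symm (volume.restrict e.target) :=
  e.continuousOn_symm.aemeasurable e.open_target.measurableSet

theorem aemeasurable_ofReal_sqrtDet (g : Metric d M)
    (he : e ∈ atlas (EuclideanSpace ℝ (Fin d)) M) :
    AEMeasurable (fun y => ENNReal.ofReal (sqrtDet g e y)) (volume.restrict e.target) :=
  ((contDiffOn_sqrtDet g he).continuousOn.aemeasurable e.open_target.measurableSet).ennreal_ofReal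

theorem measurableSet_target_inter_preimage
    (e : OpenPartialHomeomorph M (EuclideanSpace ℝ (Fin d))) {s : Set M} (hs : MeasurableSet s) :
    MeasurableSet (e.target ∩ e.symm ⁻¹' s) := by
  have h := (e.continuousOn_symm.domRestrict).measurable hs
  have := e.open_target.measurableSet.subtype_image h
  convert this using 1
  ext y
  simp [and_comm]

theorem chartVolume_apply (g : Metric d M) {s : Set M} (hs : MeasurableSet s) :
    chartVolume g e s =
      ∫⁻ y in e.target ∩ e.symm ⁻¹' s, ENNReal.ofReal (sqrtDet g e y) := by
  have h0 := (aemeasurable_symm e).mono_ac (withDensity_absolutelyContinuous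
    (volume.restrict e.target) fun y => ENNReal.ofReal (sqrtDet g e y))
  rw [chartVolume, Measure.map_apply_of_aemeasurable h0 hs]
  have h1 : ((volume.restrict e.target).withDensity fun y => ENNReal.ofReal (sqrtDet g e y))
      (e.symm ⁻¹' s) = ((volume.restrict e.target).withDensity
        fun y => ENNReal.ofReal (sqrtDet g e y)) (e.target ∩ e.symm ⁻¹' s) := by
    refine measure_congr ?_
    have : ∀ᵐ y ∂((volume.restrict e.target).withDensity
        fun y => ENNReal.ofReal (sqrtDet g e y)), y ∈ e.target :=
      (withDensity_absolutelyContinuous _ _) (ae_restrict_mem e.open_target.measurableSet)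
    filter_upwards [this] with y hy
    exact propext ⟨fun h => ⟨hy, h⟩, fun h => h.2⟩
  rw [h1, withDensity_apply _ (measurableSet_target_inter_preimage e hs),
    Measure.restrict_restrict (measurableSet_target_inter_preimage e hs)]
  congr 2
  ext y
  simp +contextual

/-- Two charts induce the same volume on the intersection of their domains. -/
theorem chartVolume_eq_of_subset (g : Metric d M) (he : e ∈ atlas (EuclideanSpace ℝ (Fin d)) M)
    (he' : e' ∈ atlas (EuclideanSpace ℝ (Fin d)) M) {s : Set M} (hs : MeasurableSet s)
    (hse : s ⊆ e.source) (hse' : s ⊆ e'.source) : chartVolume g e s = chartVolume g e' s := by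
  rw [chartVolume_apply g hs, chartVolume_apply g hs]
  -- The transition map carries one coordinate image of `s` onto the other, which sets up the change
  -- of variables.
  have himage : e'.target ∩ e'.symm ⁻¹' s = (e' ∘ e.symm) '' (e.target ∩ e.symm ⁻¹' s) := by
    ext z
    constructor
    · rintro ⟨hz, hzs⟩
      refine ⟨e (e'.symm z), ⟨e.map_source (hse hzs), ?_⟩, ?_⟩
      · simpa [e.left_inv (hse hzs)] using hzs
      · simp [e.left_inv (hse hzs), e'.right_inv hz]
    · rintro ⟨y, ⟨hy, hys⟩, rfl⟩
      refine ⟨e'.map_source (hse' hys), ?_⟩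
      simpa [e'.left_inv (hse' hys)] using hys
  rw [himage, lintegral_image_eq_lintegral_abs_det_fderiv_mul volume
    (measurableSet_target_inter_preimage e hs)
    (fun y hy => (differentiableAt_transition he he' hy.1
      (hse' hy.2)).hasFDerivAt.hasFDerivWithinAt) ?_]
  · refine setLIntegral_congr_fun (measurableSet_target_inter_preimage e hs) fun y hy => ?_
    rw [sqrtDet_eq_abs_det_mul g he he' hy.1 (hse' hy.2), ENNReal.ofReal_mul (abs_nonneg _)]
    rfl
  · rintro y ⟨hy, hys⟩ z ⟨hz, hzs⟩ hyz
    exact e.symm.injOn hy hz (e'.injOn (hse' hys) (hse' hzs) hyz)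

theorem chartVolume_eq_inter_source (g : Metric d M) {s : Set M} (hs : MeasurableSet s) :
    chartVolume g e s = chartVolume g e (s ∩ e.source) := by
  rw [chartVolume_apply g hs, chartVolume_apply g (hs.inter e.open_source.measurableSet)]
  congr 2
  ext y
  simp +contextual

/-- On the domain of a chart the Riemannian volume is the volume of the chart. -/
theorem riemannianVolume_restrict_source [T2Space M] (g : Metric d M)
    (he : e ∈ atlas (EuclideanSpace ℝ (Fin d)) M) :
    (riemannianVolume g).restrict e.source = chartVolume g e := by
  refine le_antisymm ?_ ?_
  -- The volume is a supremum of measures, so an upper bound needs one measure dominating all chart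
  -- volumes. `ν` is infinite on each nonempty measurable set outside `e.source` and equals the
  -- volume of `e` inside.
  · let ν : Measure M := chartVolume g e + (⊤ : ℝ≥0∞) • Measure.count.restrict e.sourceᶜ
    have hν : riemannianVolume g ≤ ν := by
      refine iSup₂_le fun e' he' => Measure.le_iff.2 fun s hs => ?_
      by_cases hse : s ⊆ e.source
      · calc chartVolume g e' s = chartVolume g e' (s ∩ e'.source) :=
              chartVolume_eq_inter_source g hs
          _ = chartVolume g e (s ∩ e'.source) :=
              chartVolume_eq_of_subset g he' he (hs.inter e'.open_source.measurableSet)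
                Set.inter_subset_right (Set.inter_subset_left.trans hse)
          _ ≤ chartVolume g e s := measure_mono Set.inter_subset_left
          _ ≤ ν s := by simp [ν]
      · obtain ⟨x, hxs, hx⟩ := Set.not_subset.1 hse
        have : (Measure.count.restrict e.sourceᶜ : Measure M) s ≠ 0 := by
          rw [Measure.restrict_apply hs, Ne, Measure.count_eq_zero_iff]
          exact Set.Nonempty.ne_empty ⟨x, hxs, hx⟩
        simp [ν, ENNReal.top_mul this]
    calc (riemannianVolume g).restrict e.source ≤ ν.restrict e.source :=
          Measure.restrict_mono le_rfl hν
      _ ≤ chartVolume g e := by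
        rw [Measure.restrict_add, Measure.restrict_smul, Measure.restrict_restrict
          e.open_source.measurableSet, Set.inter_compl_self]
        simp [Measure.restrict_le_self]
  · refine Measure.le_iff.2 fun s hs => ?_
    rw [chartVolume_eq_inter_source g hs, Measure.restrict_apply hs]
    exact (le_iSup₂ (f := fun e' (_ : e' ∈ atlas (EuclideanSpace ℝ (Fin d)) M) =>
      chartVolume g e') e he) _

/-- Integration in a chart. -/
theorem integral_chartVolume [SecondCountableTopology M] [T2Space M] (g : Metric d M)
    (he : e ∈ atlas (EuclideanSpace ℝ (Fin d)) M) {f : M → ℝ} (hf : ContinuousOn f e.source) :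
    ∫ x in e.source, f x ∂riemannianVolume g =
      ∫ y in e.target, sqrtDet g e y * f (e.symm y) := by
  have h0 := (aemeasurable_symm e).mono_ac (withDensity_absolutelyContinuous
    (volume.restrict e.target) fun y => ENNReal.ofReal (sqrtDet g e y))
  rw [riemannianVolume_restrict_source g he, chartVolume, integral_map h0]
  · rw [integral_withDensity_eq_integral_toReal_smul₀ (aemeasurable_ofReal_sqrtDet g he) (by simp)]
    refine setIntegral_congr_fun e.open_target.measurableSet fun y hy => ?_
    simp only [smul_eq_mul]
    rw [ENNReal.toReal_ofReal (sqrtDet_pos g he hy).le]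
  · change AEStronglyMeasurable f (chartVolume g e)
    rw [← riemannianVolume_restrict_source g he]
    exact hf.aestronglyMeasurable e.open_source.measurableSet

/-- The density is positive in every chart. This lets equality almost everywhere of continuous
functions be upgraded to equality. -/
theorem riemannianVolume_isOpenPosMeasure [T2Space M] (g : Metric d M) :
    (riemannianVolume g).IsOpenPosMeasure := by
  refine ⟨fun O hO ⟨x, hx⟩ h0 => ?_⟩
  let e := chartAt (EuclideanSpace ℝ (Fin d)) x
  have he : e ∈ atlas (EuclideanSpace ℝ (Fin d)) M := chart_mem_atlas _ x
  have h1 : chartVolume g e O = 0 := by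
    rw [← riemannianVolume_restrict_source g he]
    exact le_antisymm ((Measure.restrict_apply_le _ _).trans h0.le) bot_le
  rw [chartVolume_apply g hO.measurableSet, lintegral_eq_zero_iff'] at h1
  · have hopen : IsOpen (e.target ∩ e.symm ⁻¹' O) :=
      e.continuousOn_symm.isOpen_inter_preimage e.open_target hO
    have hne : (e.target ∩ e.symm ⁻¹' O).Nonempty :=
      ⟨e x, mem_chart_target _ x, by
        rw [Set.mem_preimage, e.left_inv (mem_chart_source _ x)]; exact hx⟩
    have h2 : ∀ᵐ y ∂(volume.restrict (e.target ∩ e.symm ⁻¹' O)), False := by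
      filter_upwards [h1, ae_restrict_mem hopen.measurableSet] with y hy hyt
      have := sqrtDet_pos g he hyt.1
      simp only [Pi.zero_apply, ENNReal.ofReal_eq_zero] at hy
      linarith
    have h3 := hopen.measure_pos (volume : Measure (EuclideanSpace ℝ (Fin d))) hne
    simp [ae_iff] at h2
    exact h3.ne' h2
  · exact (aemeasurable_ofReal_sqrtDet g he).mono_measure
      (Measure.restrict_mono Set.inter_subset_left le_rfl)

end Volume

/-! ### Integration by parts on open subsets of a vector space -/

section Euclidean

theorem continuous_of_continuousOn_of_eq_zero {X : Type*} [TopologicalSpace X] {K T : Set X}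
    (hK : IsClosed K) (hT : IsOpen T) (hKT : K ⊆ T) {h : X → ℝ} (hh : ContinuousOn h T)
    (h0 : ∀ x ∉ K, h x = 0) : Continuous h := by
  refine continuous_iff_continuousAt.2 fun x => ?_
  by_cases hx : x ∈ T
  · exact hh.continuousAt (hT.mem_nhds hx)
  · have : h =ᶠ[𝓝 x] fun _ => 0 := by
      filter_upwards [hK.isOpen_compl.mem_nhds fun hxK => hx (hKT hxK)] with z hz using h0 z hz
    exact this.continuousAt

/-- Integration by parts on an open set, for functions one of which is compactly supported. -/
theorem setIntegral_mul_fderiv_eq_neg {E : Type*} [NormedAddCommGroup E] [NormedSpace ℝ E]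
    [FiniteDimensional ℝ E] [MeasurableSpace E] [BorelSpace E] {μ : Measure E} [μ.IsAddHaarMeasure]
    {K T : Set E} (hK : IsCompact K) (hT : IsOpen T) (hKT : K ⊆ T) {u w : E → ℝ}
    (hu : ContDiffOn ℝ 1 u T) (hw : ContDiffOn ℝ 1 w T) (hu0 : ∀ y ∈ T, y ∉ K → u y = 0) (v : E) :
    IntegrableOn (fun y => w y * fderiv ℝ u y v) T μ ∧
    IntegrableOn (fun y => fderiv ℝ w y v * u y) T μ ∧
    ∫ y in T, w y * fderiv ℝ u y v ∂μ = -∫ y in T, fderiv ℝ w y v * u y ∂μ := by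
  classical
  -- Extension by zero is differentiable everywhere as `u` vanishes off `K`. The factor `w` is
  -- controlled only on `T`, but every product with `u'` or its derivative vanishes off `K`, so it
  -- is continuous on the whole space.
  let u' : E → ℝ := T.indicator u
  have huu' : ∀ y ∈ T, u' =ᶠ[𝓝 y] u := fun y hy => by
    filter_upwards [hT.mem_nhds hy] with z hz using Set.indicator_of_mem hz u
  have hu'0 : ∀ y ∉ K, u' =ᶠ[𝓝 y] fun _ => 0 := fun y hy => by
    filter_upwards [hK.isClosed.isOpen_compl.mem_nhds hy] with z hz
    by_cases hzT : z ∈ T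
    · simp [u', hzT, hu0 z hzT hz]
    · simp [u', hzT]
  have hu'd : ∀ y, DifferentiableAt ℝ u' y := fun y => by
    by_cases hy : y ∈ T
    · exact ((hu.differentiableOn one_ne_zero).differentiableAt
        (hT.mem_nhds hy)).congr_of_eventuallyEq (huu' y hy)
    · exact (differentiableAt_const _).congr_of_eventuallyEq (hu'0 y fun h => hy (hKT h))
  have hfd : ∀ y ∈ T, fderiv ℝ u' y = fderiv ℝ u y := fun y hy => (huu' y hy).fderiv_eq
  have hfd0 : ∀ y ∉ K, fderiv ℝ u' y = 0 := fun y hy => by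
    rw [(hu'0 y hy).fderiv_eq]; simp
  have hcu : ContinuousOn u' T := hu.continuousOn.congr fun y hy => (huu' y hy).self_of_nhds
  have hcfu : ContinuousOn (fun y => fderiv ℝ u' y v) T :=
    ((hu.continuousOn_fderiv_of_isOpen hT le_rfl).clm_apply continuousOn_const).congr
      fun y hy => by rw [hfd y hy]
  have hcfw : ContinuousOn (fun y => fderiv ℝ w y v) T :=
    (hw.continuousOn_fderiv_of_isOpen hT le_rfl).clm_apply continuousOn_const
  have hint : ∀ h : E → ℝ, ContinuousOn h T → (∀ y ∉ K, h y = 0) → Integrable h μ :=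
    fun h hh h0 => (continuous_of_continuousOn_of_eq_zero hK.isClosed hT hKT hh
      h0).integrable_of_hasCompactSupport (HasCompactSupport.intro hK h0)
  have hu'00 : ∀ y ∉ K, u' y = 0 := fun y hy => (hu'0 y hy).self_of_nhds
  have i1 : Integrable (fun y => w y * fderiv ℝ u' y v) μ :=
    hint _ (hw.continuousOn.mul hcfu) fun y hy => by simp [hfd0 y hy]
  have i2 : Integrable (fun y => fderiv ℝ w y v * u' y) μ :=
    hint _ (hcfw.mul hcu) fun y hy => by simp [hu'00 y hy]
  have i3 : Integrable (fun y => w y * u' y) μ :=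
    hint _ (hw.continuousOn.mul hcu) fun y hy => by simp [hu'00 y hy]
  have hts : tsupport u' ⊆ K := by
    refine closure_minimal (fun y hy => ?_) hK.isClosed
    by_contra hyK
    exact hy (hu'00 y hyK)
  have key := integral_mul_fderiv_eq_neg_fderiv_mul_of_integrable (𝕜 := ℝ) i2 i1 i3
    (fun y hy => (hw.differentiableOn one_ne_zero).differentiableAt (hT.mem_nhds (hKT (hts hy))))
    (fun y _ => hu'd y)
  have e1 : Set.EqOn (fun y => w y * fderiv ℝ u' y v) (fun y => w y * fderiv ℝ u y v) T :=
    fun y hy => by simp only [hfd y hy]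
  have e2 : Set.EqOn (fun y => fderiv ℝ w y v * u' y) (fun y => fderiv ℝ w y v * u y) T :=
    fun y hy => by simp only [(huu' y hy).self_of_nhds]
  refine ⟨i1.integrableOn.congr_fun e1 hT.measurableSet,
    i2.integrableOn.congr_fun e2 hT.measurableSet, ?_⟩
  rw [← setIntegral_congr_fun hT.measurableSet e1, ← setIntegral_congr_fun hT.measurableSet e2,
    setIntegral_eq_integral_of_forall_compl_eq_zero fun y hy => ?_,
    setIntegral_eq_integral_of_forall_compl_eq_zero fun y hy => ?_, key]
  · simp [hu'00 y fun h => hy (hKT h)]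
  · simp [hfd0 y fun h => hy (hKT h)]

end Euclidean

/-! ### Divergence in a chart and local integration by parts -/

section Divergence

variable {e e' : OpenPartialHomeomorph M (EuclideanSpace ℝ (Fin d))}
  {X : ∀ x : M, TangentSpace (𝓡 d) x}

/-- The divergence computed in the chart `e`, as a function of the coordinates. -/
def chartDivergence (g : Metric d M) (e : OpenPartialHomeomorph M (EuclideanSpace ℝ (Fin d)))
    (X : ∀ x : M, TangentSpace (𝓡 d) x) (y : EuclideanSpace ℝ (Fin d)) : ℝ :=
  (sqrtDet g e y)⁻¹ * ∑ j : Fin d, fderiv ℝ (fun y => component e X j y * sqrtDet g e y) y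
    (EuclideanSpace.single j (1 : ℝ))

/-- The vector field `X` has components of class `C^1` in all charts. -/
def HasC1Components (X : ∀ x : M, TangentSpace (𝓡 d) x) : Prop :=
  ∀ e ∈ atlas (EuclideanSpace ℝ (Fin d)) M, ∀ j, ContDiffOn ℝ 1 (component e X j) e.target

theorem HasC1Components.contDiffOn_mul_sqrtDet (hX : HasC1Components X) (g : Metric d M)
    (he : e ∈ atlas (EuclideanSpace ℝ (Fin d)) M) (j : Fin d) :
    ContDiffOn ℝ 1 (fun y => component e X j y * sqrtDet g e y) e.target :=
  (hX e he j).mul ((contDiffOn_sqrtDet g he).of_le (by norm_cast))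

theorem HasC1Components.continuousOn_chartDivergence (hX : HasC1Components X) (g : Metric d M)
    (he : e ∈ atlas (EuclideanSpace ℝ (Fin d)) M) :
    ContinuousOn (chartDivergence g e X) e.target := by
  refine ContinuousOn.mul ((contDiffOn_sqrtDet g he).continuousOn.inv₀
    fun y hy => (sqrtDet_pos g he hy).ne') (continuousOn_finsetSum _ fun j _ => ?_)
  exact ((hX.contDiffOn_mul_sqrtDet g he j).continuousOn_fderiv_of_isOpen e.open_target
    le_rfl).clm_apply continuousOn_const

theorem HasC1Components.continuousOn_chartDivergence_comp (hX : HasC1Components X)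
    (g : Metric d M) (he : e ∈ atlas (EuclideanSpace ℝ (Fin d)) M) :
    ContinuousOn (fun x => chartDivergence g e X (e x)) e.source :=
  (hX.continuousOn_chartDivergence g he).comp e.continuousOn e.mapsTo

theorem HasC1Components.continuous_mvfderiv (hX : HasC1Components X) {f : M → ℝ}
    (hf : ContMDiff (𝓡 d) 𝓘(ℝ, ℝ) 1 f) :
    Continuous fun x => mvfderiv (𝓡 d) f x (X x) := by
  refine continuous_iff_continuousAt.2 fun x => ?_
  let e := chartAt (EuclideanSpace ℝ (Fin d)) x
  have he : e ∈ atlas (EuclideanSpace ℝ (Fin d)) M := chart_mem_atlas _ x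
  have h1 : ContinuousOn (fun y => ∑ j, component e X j y *
      fderiv ℝ (f ∘ e.symm) y (EuclideanSpace.single j 1)) e.target :=
    continuousOn_finsetSum _ fun j _ => (hX e he j).continuousOn.mul
      (contDiffOn_fderiv_comp_symm (m := 0) he (by norm_cast) (by simp) hf _).continuousOn
  have h2 := h1.comp e.continuousOn e.mapsTo
  have h3 : ContinuousOn (fun x => mvfderiv (𝓡 d) f x (X x)) e.source := h2.congr fun z hz => by
    have h4 := mvfderiv_eq_sum he (e.map_source hz) (f := f)
      (hf.mdifferentiableAt one_ne_zero) X
    rw [e.left_inv hz] at h4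
    exact h4
  exact h3.continuousAt (e.open_source.mem_nhds (mem_chart_source _ x))

theorem mvfderiv_eq_zero_of_notMem_tsupport {f : M → ℝ} {x : M} (hx : x ∉ tsupport f) :
    mvfderiv (𝓡 d) f x = 0 := by
  have h : f =ᶠ[𝓝 x] fun _ => 0 := notMem_tsupport_iff_eventuallyEq.1 hx
  have h1 := h.mfderiv_eq (I := 𝓡 d) (I' := 𝓘(ℝ, ℝ))
  ext v
  have h2 := DFunLike.congr_fun (mvfderiv_const (I := 𝓡 d) (0 : ℝ) (x := x)) v
  refine Eq.trans ?_ h2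
  exact DFunLike.congr_fun h1 v

theorem HasC1Components.continuous_mul_chartDivergence (hX : HasC1Components X) (g : Metric d M)
    (he : e ∈ atlas (EuclideanSpace ℝ (Fin d)) M) {f : M → ℝ} (hf : Continuous f)
    (hfe : tsupport f ⊆ e.source) : Continuous fun x => f x * chartDivergence g e X (e x) :=
  continuous_of_continuousOn_of_eq_zero (isClosed_tsupport f) e.open_source hfe
    (hf.continuousOn.mul (hX.continuousOn_chartDivergence_comp g he))
    fun x hx => by simp [image_eq_zero_of_notMem_tsupport hx]

theorem hasC1Components_of_contMDiff
    (hX : ContMDiff (𝓡 d) (𝓡 d).tangent 1 (fun x => (⟨x, X x⟩ : TangentBundle (𝓡 d) M))) :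
    HasC1Components X := fun _ he j => contDiffOn_component he hX j

theorem hasC1Components_grad (g : Metric d M) {f : M → ℝ} (hf : ContMDiff (𝓡 d) 𝓘(ℝ, ℝ) ∞ f) :
    HasC1Components (grad g f) := fun _ he j =>
  (contDiffOn_component_grad g he hf j).of_le (by norm_cast)

theorem component_smul (e : OpenPartialHomeomorph M (EuclideanSpace ℝ (Fin d))) (φ : M → ℝ)
    (X : ∀ x : M, TangentSpace (𝓡 d) x) (j : Fin d) (y : EuclideanSpace ℝ (Fin d)) :
    component e (fun x => φ x • X x) j y = φ (e.symm y) * component e X j y := by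
  simp [component]

theorem HasC1Components.smul (hX : HasC1Components X) {φ : M → ℝ}
    (hφ : ContMDiff (𝓡 d) 𝓘(ℝ, ℝ) 1 φ) : HasC1Components fun x => φ x • X x := fun e he j => by
  rw [show component e (fun x => φ x • X x) j = fun y => φ (e.symm y) * component e X j y from
    funext (component_smul e φ X j)]
  exact (contDiffOn_comp_symm he (by norm_cast) hφ).mul (hX e he j)

theorem mvfderiv_finset_sum {ι : Type*} (s : Finset ι) {F : ι → M → ℝ} {x : M}
    (hF : ∀ i, MDifferentiableAt (𝓡 d) 𝓘(ℝ, ℝ) (F i) x) (v : TangentSpace (𝓡 d) x) :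
    mvfderiv (𝓡 d) (fun x => ∑ i ∈ s, F i x) x v = ∑ i ∈ s, mvfderiv (𝓡 d) (F i) x v := by
  classical
  suffices h : MDifferentiableAt (𝓡 d) 𝓘(ℝ, ℝ) (fun x => ∑ i ∈ s, F i x) x ∧
      mvfderiv (𝓡 d) (fun x => ∑ i ∈ s, F i x) x v = ∑ i ∈ s, mvfderiv (𝓡 d) (F i) x v from h.2
  induction s using Finset.induction_on with
  | empty => simp [mdifferentiableAt_const, mvfderiv_const]
  | insert i s hi ih =>
    simp only [Finset.sum_insert hi]
    refine ⟨(hF i).add ih.1, ?_⟩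
    rw [mvfderiv_fun_add (hF i) ih.1, add_apply, ih.2]

/-- The product rule for the divergence. -/
theorem HasC1Components.divergence_smul (hX : HasC1Components X) (g : Metric d M) {φ : M → ℝ}
    (hφ : ContMDiff (𝓡 d) 𝓘(ℝ, ℝ) 1 φ) (x : M) :
    divergence g (fun x => φ x • X x) x =
      φ x * divergence g X x + mvfderiv (𝓡 d) φ x (X x) := by
  let e := chartAt (EuclideanSpace ℝ (Fin d)) x
  have he : e ∈ atlas (EuclideanSpace ℝ (Fin d)) M := chart_mem_atlas _ x
  have hx : x ∈ e.source := mem_chart_source _ x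
  have hy : e x ∈ e.target := e.map_source hx
  have h1 := mvfderiv_eq_sum he hy (f := φ) (hφ.mdifferentiableAt one_ne_zero) X
  rw [e.left_inv hx] at h1
  have h2 : ∀ j, fderiv ℝ (fun y => component e (fun x => φ x • X x) j y * sqrtDet g e y) (e x)
      (EuclideanSpace.single j 1) =
      φ x * fderiv ℝ (fun y => component e X j y * sqrtDet g e y) (e x)
        (EuclideanSpace.single j 1) + component e X j (e x) * sqrtDet g e (e x) *
          fderiv ℝ (φ ∘ e.symm) (e x) (EuclideanSpace.single j 1) := fun j => by
    have d1 : DifferentiableAt ℝ (φ ∘ e.symm) (e x) :=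
      ((contDiffOn_comp_symm he (by norm_cast) hφ).differentiableOn
        one_ne_zero).differentiableAt (e.open_target.mem_nhds hy)
    have d2 : DifferentiableAt ℝ (fun y => component e X j y * sqrtDet g e y) (e x) :=
      ((hX.contDiffOn_mul_sqrtDet g he j).differentiableOn
        one_ne_zero).differentiableAt (e.open_target.mem_nhds hy)
    have h3 : (fun y => component e (fun x => φ x • X x) j y * sqrtDet g e y) =
        (φ ∘ e.symm) * fun y => component e X j y * sqrtDet g e y := by
      ext y
      simp [component_smul, mul_assoc]
    rw [h3, fderiv_mul d1 d2]
    simp [e.left_inv hx]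
  have h4 := (sqrtDet_pos g he hy).ne'
  change (sqrtDet g e (e x))⁻¹ * _ = φ x * ((sqrtDet g e (e x))⁻¹ * _) + _
  rw [Finset.sum_congr rfl fun j _ => h2 j, Finset.sum_add_distrib, ← Finset.mul_sum, h1, mul_add]
  congr 1
  · ring
  · rw [Finset.mul_sum]
    exact Finset.sum_congr rfl fun j _ => by field_simp

variable [T2Space M] [CompactSpace M] [MeasurableSpace M] [BorelSpace M]

/-- Integration by parts in a chart. -/
theorem HasC1Components.integral_mvfderiv_of_tsupport_subset (hX : HasC1Components X)
    (g : Metric d M) (he : e ∈ atlas (EuclideanSpace ℝ (Fin d)) M) {f : M → ℝ}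
    (hf : ContMDiff (𝓡 d) 𝓘(ℝ, ℝ) 1 f) (hfe : tsupport f ⊆ e.source) :
    ∫ x, mvfderiv (𝓡 d) f x (X x) ∂riemannianVolume g =
      -∫ x, f x * chartDivergence g e X (e x) ∂riemannianVolume g := by
  have : SecondCountableTopology M :=
    ChartedSpace.secondCountable_of_sigmaCompact (EuclideanSpace ℝ (Fin d)) M
  have hf0 : ∀ x ∉ e.source, f x = 0 := fun x hx => image_eq_zero_of_notMem_tsupport
    fun h => hx (hfe h)
  rw [← setIntegral_eq_integral_of_forall_compl_eq_zero (s := e.source) fun x hx => by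
      rw [mvfderiv_eq_zero_of_notMem_tsupport fun h => hx (hfe h)]; rfl,
    ← setIntegral_eq_integral_of_forall_compl_eq_zero (s := e.source)
      (f := fun x => f x * chartDivergence g e X (e x)) fun x hx => by simp [hf0 x hx],
    integral_chartVolume g he (hX.continuous_mvfderiv hf).continuousOn,
    integral_chartVolume g he (f := fun x => f x * chartDivergence g e X (e x))
      (hf.continuous.continuousOn.mul (hX.continuousOn_chartDivergence_comp g he))]
  -- The coordinate image of the support is the compact set required for integration by parts.
  let K := e '' tsupport f
  have hK : IsCompact K := (isClosed_tsupport f).isCompact.image_of_continuousOn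
    (e.continuousOn.mono hfe)
  have hKT : K ⊆ e.target := by
    rintro _ ⟨x, hx, rfl⟩; exact e.map_source (hfe hx)
  have hu := contDiffOn_comp_symm he (n := 1) (by norm_cast) hf
  have hu0 : ∀ y ∈ e.target, y ∉ K → (f ∘ e.symm) y = 0 := fun y hy hyK =>
    image_eq_zero_of_notMem_tsupport (f := f) fun h => hyK ⟨_, h, e.right_inv hy⟩
  have hparts := fun j => setIntegral_mul_fderiv_eq_neg (μ := volume) hK e.open_target hKT hu
    (hX.contDiffOn_mul_sqrtDet g he j) hu0 (EuclideanSpace.single j 1)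
  have e1 : ∫ y in e.target, sqrtDet g e y * mvfderiv (𝓡 d) f (e.symm y) (X (e.symm y)) =
      ∫ y in e.target, ∑ j, component e X j y * sqrtDet g e y *
        fderiv ℝ (f ∘ e.symm) y (EuclideanSpace.single j 1) := by
    refine setIntegral_congr_fun e.open_target.measurableSet fun y hy => ?_
    rw [mvfderiv_eq_sum he hy (hf.mdifferentiableAt one_ne_zero), Finset.mul_sum]
    exact Finset.sum_congr rfl fun j _ => by ring
  have e2 : ∫ y in e.target, sqrtDet g e y *
        (f (e.symm y) * chartDivergence g e X (e (e.symm y))) =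
      ∫ y in e.target, ∑ j, fderiv ℝ (fun y => component e X j y * sqrtDet g e y) y
        (EuclideanSpace.single j 1) * (f ∘ e.symm) y := by
    refine setIntegral_congr_fun e.open_target.measurableSet fun y hy => ?_
    rw [e.right_inv hy, chartDivergence, ← Finset.sum_mul]
    have := (sqrtDet_pos g he hy).ne'
    simp only [Function.comp_apply]
    field_simp
  rw [e1, e2, integral_finsetSum _ fun j _ => (hparts j).1,
    integral_finsetSum _ fun j _ => (hparts j).2.1, ← Finset.sum_neg_distrib]
  exact Finset.sum_congr rfl fun j _ => (hparts j).2.2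

end Divergence

/-! ### Chart independence of the divergence and the divergence theorem -/

section GlobalDivergence

variable {e e' : OpenPartialHomeomorph M (EuclideanSpace ℝ (Fin d))}
  {X : ∀ x : M, TangentSpace (𝓡 d) x} [T2Space M] [CompactSpace M] [MeasurableSpace M]
  [BorelSpace M]

/-- The divergence does not depend on the chart in which it is computed. -/
theorem HasC1Components.chartDivergence_eq (hX : HasC1Components X) (g : Metric d M)
    [IsFiniteMeasure (riemannianVolume g)] (he : e ∈ atlas (EuclideanSpace ℝ (Fin d)) M)
    (he' : e' ∈ atlas (EuclideanSpace ℝ (Fin d)) M) {x : M} (hx : x ∈ e.source)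
    (hx' : x ∈ e'.source) : chartDivergence g e X (e x) = chartDivergence g e' X (e' x) := by
  have : SecondCountableTopology M :=
    ChartedSpace.secondCountable_of_sigmaCompact (EuclideanSpace ℝ (Fin d)) M
  have hO : IsOpen (e.source ∩ e'.source) := e.open_source.inter e'.open_source
  have hc : ContinuousOn (fun x => chartDivergence g e X (e x)) (e.source ∩ e'.source) :=
    (hX.continuousOn_chartDivergence_comp g he).mono Set.inter_subset_left
  have hc' : ContinuousOn (fun x => chartDivergence g e' X (e' x)) (e.source ∩ e'.source) :=
    (hX.continuousOn_chartDivergence_comp g he').mono Set.inter_subset_right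
  -- Weak argument: for `f` supported in the overlap, both coordinate expressions satisfy the same
  -- integration by parts formula, whose left side involves no chart. This avoids differentiating
  -- the Jacobian of the transition map.
  have hae := hO.ae_eq_zero_of_integral_contMDiff_smul_eq_zero (𝓡 d) (μ := riemannianVolume g)
    ((hc.sub hc').locallyIntegrableOn hO.measurableSet) fun f hf _ hfO => by
      have hs := hfO.trans Set.inter_subset_left
      have hs' := hfO.trans Set.inter_subset_right
      have i1 := (hX.continuous_mul_chartDivergence g he hf.continuous
        hs).integrable_of_hasCompactSupport (μ := riemannianVolume g)
          (HasCompactSupport.of_compactSpace _)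
      have i2 := (hX.continuous_mul_chartDivergence g he' hf.continuous
        hs').integrable_of_hasCompactSupport (μ := riemannianVolume g)
          (HasCompactSupport.of_compactSpace _)
      have hf1 : ContMDiff (𝓡 d) 𝓘(ℝ, ℝ) 1 f := hf.of_le (by norm_cast)
      have h1 := hX.integral_mvfderiv_of_tsupport_subset g he hf1 hs
      have h2 := hX.integral_mvfderiv_of_tsupport_subset g he' hf1 hs'
      simp only [Pi.sub_apply, smul_eq_mul, mul_sub]
      rw [integral_sub i1 i2]
      linarith
  have := riemannianVolume_isOpenPosMeasure g
  refine Measure.eqOn_open_of_ae_eq (μ := riemannianVolume g) ?_ hO hc hc' ⟨hx, hx'⟩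
  refine (ae_restrict_iff' hO.measurableSet).2 (hae.mono fun z hz hzO => ?_)
  exact sub_eq_zero.1 (hz hzO)

theorem HasC1Components.divergence_eq (hX : HasC1Components X) (g : Metric d M)
    [IsFiniteMeasure (riemannianVolume g)] (he : e ∈ atlas (EuclideanSpace ℝ (Fin d)) M)
    {x : M} (hx : x ∈ e.source) : divergence g X x = chartDivergence g e X (e x) :=
  hX.chartDivergence_eq g (chart_mem_atlas _ x) he (mem_chart_source _ x) hx

theorem HasC1Components.continuous_divergence (hX : HasC1Components X) (g : Metric d M)
    [IsFiniteMeasure (riemannianVolume g)] : Continuous (divergence g X) := by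
  refine continuous_iff_continuousAt.2 fun x => ?_
  have he := chart_mem_atlas (EuclideanSpace ℝ (Fin d)) x
  have h : ContinuousOn (divergence g X) (chartAt (EuclideanSpace ℝ (Fin d)) x).source :=
    (hX.continuousOn_chartDivergence_comp g he).congr fun z hz => hX.divergence_eq g he hz
  exact h.continuousAt ((chartAt _ x).open_source.mem_nhds (mem_chart_source _ x))

/-- The divergence theorem in the form of an integration by parts formula. -/
theorem HasC1Components.integral_mvfderiv (hX : HasC1Components X) (g : Metric d M)
    [IsFiniteMeasure (riemannianVolume g)] {f : M → ℝ} (hf : ContMDiff (𝓡 d) 𝓘(ℝ, ℝ) 1 f) :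
    ∫ x, mvfderiv (𝓡 d) f x (X x) ∂riemannianVolume g =
      -∫ x, f x * divergence g X x ∂riemannianVolume g := by
  -- A finite subcover makes the partition of unity a finite sum, which commutes with derivatives
  -- and integrals.
  obtain ⟨t, ht⟩ := isCompact_univ.elim_finite_subcover
    (fun x : M => (chartAt (EuclideanSpace ℝ (Fin d)) x).source)
    (fun x => (chartAt _ x).open_source)
    (fun x _ => Set.mem_iUnion.2 ⟨x, mem_chart_source _ x⟩)
  obtain ⟨ρ, hρ⟩ := SmoothPartitionOfUnity.exists_isSubordinate (𝓡 d) (isClosed_univ (X := M))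
    (fun x : t => (chartAt (EuclideanSpace ℝ (Fin d)) (x : M)).source)
    (fun x => (chartAt _ _).open_source) (fun x hx => by
      obtain ⟨i, hi, hxi⟩ := Set.mem_iUnion₂.1 (ht hx)
      exact Set.mem_iUnion.2 ⟨⟨i, hi⟩, hxi⟩)
  have hρf : ∀ i, ContMDiff (𝓡 d) 𝓘(ℝ, ℝ) 1 fun x => ρ i x * f x := fun i =>
    ((ρ i).contMDiff.of_le (by norm_cast)).mul hf
  have hsupp : ∀ i : t, tsupport (fun x => ρ i x * f x) ⊆
      (chartAt (EuclideanSpace ℝ (Fin d)) (i : M)).source := fun i =>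
    (tsupport_mul_subset_left (f := fun x => ρ i x)).trans (hρ i)
  have hsum : ∀ x, f x = ∑ i, ρ i x * f x := fun x => by
    have h := ρ.sum_eq_one (Set.mem_univ x)
    rw [finsum_eq_sum_of_fintype] at h
    rw [← Finset.sum_mul, h, one_mul]
  have hdsum : ∀ x, mvfderiv (𝓡 d) f x (X x) =
      ∑ i, mvfderiv (𝓡 d) (fun x => ρ i x * f x) x (X x) := fun x => by
    conv_lhs => rw [show f = fun x => ∑ i, ρ i x * f x from funext hsum]
    exact mvfderiv_finset_sum _ (fun i => (hρf i).mdifferentiableAt one_ne_zero) _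
  have hint : ∀ h : M → ℝ, Continuous h → Integrable h (riemannianVolume g) := fun h hh =>
    hh.integrable_of_hasCompactSupport (HasCompactSupport.of_compactSpace _)
  have hcd := hX.continuous_divergence g
  calc ∫ x, mvfderiv (𝓡 d) f x (X x) ∂riemannianVolume g
      = ∑ i, ∫ x, mvfderiv (𝓡 d) (fun x => ρ i x * f x) x (X x) ∂riemannianVolume g := by
        simp only [hdsum]
        exact integral_finsetSum _ fun i _ => hint _ (hX.continuous_mvfderiv (hρf i))
    _ = ∑ i, -∫ x, ρ i x * f x * divergence g X x ∂riemannianVolume g := by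
        refine Finset.sum_congr rfl fun i _ => ?_
        have he := chart_mem_atlas (EuclideanSpace ℝ (Fin d)) (i : M)
        rw [hX.integral_mvfderiv_of_tsupport_subset g he (hρf i) (hsupp i)]
        congr 1
        refine integral_congr_ae (Eventually.of_forall fun x => ?_)
        by_cases hx : x ∈ (chartAt (EuclideanSpace ℝ (Fin d)) (i : M)).source
        · simp only [hX.divergence_eq g he hx]
        · have h0 : ρ i x * f x = 0 :=
            image_eq_zero_of_notMem_tsupport (f := fun x => ρ i x * f x) fun h => hx (hsupp i h)
          simp [h0]
    _ = -∫ x, f x * divergence g X x ∂riemannianVolume g := by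
        rw [Finset.sum_neg_distrib, ← integral_finsetSum
          (f := fun i x => ρ i x * f x * divergence g X x) _ fun i _ =>
          hint _ ((hρf i).continuous.mul hcd)]
        simp only [← Finset.sum_mul, ← hsum]

end GlobalDivergence

/-! ### Integration by parts for the Gibbs measure -/

section Gibbs

variable {U : M → ℝ} {X : ∀ x : M, TangentSpace (𝓡 d) x}

theorem contMDiff_exp_neg (hU : ContMDiff (𝓡 d) 𝓘(ℝ, ℝ) 1 U) :
    ContMDiff (𝓡 d) 𝓘(ℝ, ℝ) 1 fun x => Real.exp (-U x) :=
  Real.contDiff_exp.contMDiff.comp hU.neg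

theorem mvfderiv_exp_neg (hU : ContMDiff (𝓡 d) 𝓘(ℝ, ℝ) 1 U) (x : M) (v : TangentSpace (𝓡 d) x) :
    mvfderiv (𝓡 d) (fun x => Real.exp (-U x)) x v =
      -(Real.exp (-U x) * mvfderiv (𝓡 d) U x v) := by
  have hd : HasDerivAt (fun t : ℝ => Real.exp (-t)) (-Real.exp (-U x)) (U x) := by
    simpa using (hasDerivAt_neg (U x)).exp
  have hUx : MDifferentiableAt (𝓡 d) 𝓘(ℝ, ℝ) U x := hU.mdifferentiableAt one_ne_zero
  have h := hd.hasFDerivAt.hasMFDerivAt.comp x hUx.hasMFDerivAt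
  have h1 := h.mfderiv
  have h2 : mvfderiv (𝓡 d) (fun x => Real.exp (-U x)) x v =
      mvfderiv (𝓡 d) U x v * -Real.exp (-U x) := by
    exact DFunLike.congr_fun h1 v
  rw [h2]; ring

theorem driftOp_eq_mvfderiv (g : Metric d M) (b : ∀ x : M, TangentSpace (𝓡 d) x) (f : M → ℝ)
    (x : M) : driftOp g b f x = mvfderiv (𝓡 d) f x (b x) := by
  rw [driftOp, g.symm, inner_grad]

theorem inner_self_nonneg_of_metric (g : Metric d M) (x : M) (v : TangentSpace (𝓡 d) x) :
    0 ≤ g.inner x v v := by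
  by_cases hv : v = 0
  · simp [hv]
  · exact (g.pos x v hv).le

/-- Nonpositive discriminant of the nonnegative polynomial `t ↦ g(t v + w, t v + w)`. -/
theorem inner_sq_le (g : Metric d M) (x : M) (v w : TangentSpace (𝓡 d) x) :
    (g.inner x v w) ^ 2 ≤ g.inner x v v * g.inner x w w := by
  have h : ∀ t : ℝ, 0 ≤ g.inner x v v * (t * t) + 2 * g.inner x v w * t + g.inner x w w :=
    fun t => by
      have := inner_self_nonneg_of_metric g x (t • v + w)
      simp only [map_add, map_smul, add_apply, smul_apply, smul_eq_mul] at this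
      rw [g.symm x w v] at this
      linarith
  have := discrim_le_zero h
  rw [discrim] at this
  nlinarith

theorem exists_bound_inner_self [CompactSpace M] (g : Metric d M) {b : ∀ x : M, TangentSpace (𝓡 d) x}
    (hb : ContMDiff (𝓡 d) (𝓡 d).tangent 1 (fun x => (⟨x, b x⟩ : TangentBundle (𝓡 d) M))) :
    ∃ C, ∀ x, g.inner x (b x) (b x) ≤ C := by
  have hc : Continuous fun x => g.inner x (b x) (b x) := by
    have h : ContMDiff (𝓡 d) ((𝓡 d).prod 𝓘(ℝ)) 1
        (fun m => Bundle.TotalSpace.mk' ℝ (E := Bundle.Trivial M ℝ) m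
          (g.inner m (b m) (b m))) := fun x => by
      apply ContMDiffAt.clm_bundle_apply₂ (F₁ := EuclideanSpace ℝ (Fin d))
        (F₂ := EuclideanSpace ℝ (Fin d))
      · exact (g.contMDiff.of_le (by norm_cast)) x
      · exact hb x
      · exact hb x
    have h' : ContMDiff (𝓡 d) 𝓘(ℝ) 1 fun m => g.inner m (b m) (b m) := fun x => by
      have := h x
      simp only [Bundle.contMDiffAt_totalSpace] at this
      exact this.2
    exact h'.continuous
  obtain ⟨C, hC⟩ := isCompact_univ.bddAbove_image hc.continuousOn
  exact ⟨C, fun x => hC ⟨x, trivial, rfl⟩⟩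

variable [MeasurableSpace M]

/-- By compactness `U` is bounded above, so `exp (-U)` is bounded below by a positive constant and
finiteness transfers from the Gibbs measure. -/
theorem isFiniteMeasure_riemannianVolume [CompactSpace M] (g : Metric d M) (hU : Continuous U)
    [IsFiniteMeasure (gibbsMeasure g U)] : IsFiniteMeasure (riemannianVolume g) := by
  obtain ⟨K, hK⟩ := isCompact_univ.bddAbove_image hU.continuousOn
  have hK' : ∀ x, U x ≤ K := fun x => hK ⟨x, trivial, rfl⟩
  refine ⟨?_⟩
  have h1 : ENNReal.ofReal (Real.exp (-K)) * riemannianVolume g Set.univ ≤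
      gibbsMeasure g U Set.univ := by
    rw [gibbsMeasure, withDensity_apply _ MeasurableSet.univ, ← setLIntegral_const]
    refine lintegral_mono fun x => ENNReal.ofReal_le_ofReal ?_
    exact Real.exp_le_exp.2 (neg_le_neg (hK' x))
  have h2 := h1.trans_lt (measure_lt_top _ _)
  exact ENNReal.lt_top_of_mul_ne_top_right h2.ne (by simp [Real.exp_pos])

theorem integral_gibbsMeasure [BorelSpace M] (g : Metric d M) (hU : Continuous U) (f : M → ℝ) :
    ∫ x, f x ∂gibbsMeasure g U = ∫ x, Real.exp (-U x) * f x ∂riemannianVolume g := by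
  rw [gibbsMeasure, integral_withDensity_eq_integral_toReal_smul (by fun_prop) (by simp)]
  simp only [smul_eq_mul, ENNReal.toReal_ofReal (Real.exp_pos _).le]

variable [T2Space M] [CompactSpace M] [BorelSpace M]

/-- The weight is absorbed into the vector field, and the divergence theorem is applied to `exp (-U)
X`. -/
theorem HasC1Components.integral_gibbsMeasure_mvfderiv (hX : HasC1Components X) (g : Metric d M)
    (hU : ContMDiff (𝓡 d) 𝓘(ℝ, ℝ) 1 U) [IsFiniteMeasure (gibbsMeasure g U)] {f : M → ℝ}
    (hf : ContMDiff (𝓡 d) 𝓘(ℝ, ℝ) 1 f) :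
    ∫ x, mvfderiv (𝓡 d) f x (X x) ∂gibbsMeasure g U =
      -∫ x, f x * divergence g (fun x => Real.exp (-U x) • X x) x ∂riemannianVolume g := by
  have := isFiniteMeasure_riemannianVolume g hU.continuous
  rw [integral_gibbsMeasure g hU.continuous,
    ← (hX.smul (contMDiff_exp_neg hU)).integral_mvfderiv g hf]
  simp

theorem continuous_diffOp (g : Metric d M) (hU : ContMDiff (𝓡 d) 𝓘(ℝ, ℝ) 1 U)
    [IsFiniteMeasure (gibbsMeasure g U)] {v : M → ℝ} (hv : ContMDiff (𝓡 d) 𝓘(ℝ, ℝ) ∞ v) :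
    Continuous (diffOp g U v) := by
  have := isFiniteMeasure_riemannianVolume g hU.continuous
  have hX := hasC1Components_grad g hv
  refine (hX.continuous_divergence g).sub ?_
  simpa only [inner_grad] using hX.continuous_mvfderiv hU

/-- The symmetric form is given by the operator `Δ - ∇U · ∇`. -/
theorem integral_inner_grad (g : Metric d M) (hU : ContMDiff (𝓡 d) 𝓘(ℝ, ℝ) 1 U)
    [IsFiniteMeasure (gibbsMeasure g U)] {f v : M → ℝ} (hf : ContMDiff (𝓡 d) 𝓘(ℝ, ℝ) 1 f)
    (hv : ContMDiff (𝓡 d) 𝓘(ℝ, ℝ) ∞ v) :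
    ∫ x, g.inner x (grad g f x) (grad g v x) ∂gibbsMeasure g U =
      -∫ x, f x * diffOp g U v x ∂gibbsMeasure g U := by
  have hX := hasC1Components_grad g hv
  simp only [inner_grad]
  rw [hX.integral_gibbsMeasure_mvfderiv g hU hf, integral_gibbsMeasure g hU.continuous]
  congr 1
  refine integral_congr_ae (Eventually.of_forall fun x => ?_)
  -- The product rule gives `div (exp (-U) ∇v) = exp (-U) (Δv - ∇U · ∇v)`.
  simp only [hX.divergence_smul g (contMDiff_exp_neg hU), mvfderiv_exp_neg hU, diffOp, inner_grad,
    laplacian]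
  ring

/-- A drift with `div (e^{-U} b) = 0` is antisymmetric. -/
theorem integral_driftOp_mul (g : Metric d M) (hU : ContMDiff (𝓡 d) 𝓘(ℝ, ℝ) 1 U)
    [IsFiniteMeasure (gibbsMeasure g U)] (hX : HasC1Components X)
    (hdiv : ∀ x, divergence g (fun y => Real.exp (-U y) • X y) x = 0) {f v : M → ℝ}
    (hf : ContMDiff (𝓡 d) 𝓘(ℝ, ℝ) 1 f) (hv : ContMDiff (𝓡 d) 𝓘(ℝ, ℝ) 1 v) :
    ∫ x, driftOp g X f x * v x ∂gibbsMeasure g U =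
      -∫ x, f x * driftOp g X v x ∂gibbsMeasure g U := by
  -- The derivative of the product `f v` along the drift has integral zero; Leibniz splits it into
  -- the two sides.
  have h := hX.integral_gibbsMeasure_mvfderiv g hU (hf.mul hv)
  simp only [hdiv, mul_zero, integral_zero, neg_zero] at h
  have hint : ∀ h : M → ℝ, Continuous h → Integrable h (gibbsMeasure g U) := fun h hh =>
    hh.integrable_of_hasCompactSupport (HasCompactSupport.of_compactSpace _)
  simp only [driftOp_eq_mvfderiv]
  rw [eq_neg_iff_add_eq_zero, ← integral_add
    (f := fun x => mvfderiv (𝓡 d) f x (X x) * v x) (g := fun x => f x * mvfderiv (𝓡 d) v x (X x))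
    (hint _ ((hX.continuous_mvfderiv hf).mul hv.continuous))
    (hint _ (hf.continuous.mul (hX.continuous_mvfderiv hv))), ← h]
  refine integral_congr_ae (Eventually.of_forall fun x => ?_)
  change _ = mvfderiv (𝓡 d) (f * v) x (X x)
  rw [mvfderiv_mul (hf.mdifferentiableAt one_ne_zero) (hv.mdifferentiableAt one_ne_zero)]
  simp [mul_comm, add_comm]

end Gibbs

/-! ### The manifold as an instance of the abstract setting -/

section Assembly

open scoped InnerProductSpace

theorem secondCountableTopology_of_compact (d : ℕ) (M : Type*) [TopologicalSpace M]
    [CompactSpace M] [ChartedSpace (EuclideanSpace ℝ (Fin d)) M] : SecondCountableTopology M :=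
  ChartedSpace.secondCountable_of_sigmaCompact (EuclideanSpace ℝ (Fin d)) M

theorem contMDiff_one (f : SmoothFn d M) : ContMDiff (𝓡 d) 𝓘(ℝ, ℝ) 1 f :=
  f.contMDiff.of_le (by norm_cast)

theorem mvfderiv_smoothFn_add (f h : SmoothFn d M) (x : M) :
    mvfderiv (𝓡 d) (⇑f + ⇑h) x = mvfderiv (𝓡 d) f x + mvfderiv (𝓡 d) h x :=
  mvfderiv_add f.mdifferentiableAt h.mdifferentiableAt

theorem mvfderiv_smoothFn_smul (c : ℝ) (f : SmoothFn d M) (x : M) :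
    mvfderiv (𝓡 d) (c • ⇑f) x = c • mvfderiv (𝓡 d) f x := by
  have h := mvfderiv_smul (I := 𝓡 d) (a := fun _ : M => c) (g := f) (x := x)
    mdifferentiableAt_const f.mdifferentiableAt
  refine h.trans ?_
  rw [mvfderiv_const]
  ext v
  simp

theorem grad_smoothFn_add (g : Metric d M) (f h : SmoothFn d M) (x : M) :
    grad g (⇑f + ⇑h) x = grad g f x + grad g h x := by
  rw [grad, mvfderiv_smoothFn_add]
  simp [grad]

theorem grad_smoothFn_smul (g : Metric d M) (c : ℝ) (f : SmoothFn d M) (x : M) :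
    grad g (c • ⇑f) x = c • grad g f x := by
  rw [grad, mvfderiv_smoothFn_smul]
  simp [grad]

/-- The function `∇f · ∇h`. -/
def gradInner (g : Metric d M) (f h : SmoothFn d M) (x : M) : ℝ :=
  g.inner x (grad g f x) (grad g h x)

theorem continuous_gradInner (g : Metric d M) (f h : SmoothFn d M) :
    Continuous (gradInner g f h) := by
  unfold gradInner
  simp only [inner_grad]
  exact (hasC1Components_grad g h.contMDiff).continuous_mvfderiv (contMDiff_one f)

/-- A smooth function as a continuous function. -/
def smoothToContinuous (d : ℕ) (M : Type*) [TopologicalSpace M]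
    [ChartedSpace (EuclideanSpace ℝ (Fin d)) M] : SmoothFn d M →ₗ[ℝ] C(M, ℝ) where
  toFun f := ⟨f, f.contMDiff.continuous⟩
  map_add' _ _ := rfl
  map_smul' _ _ := rfl

theorem denseRange_smoothToContinuous [T2Space M] [CompactSpace M] : DenseRange (smoothToContinuous d M) := by
  refine Metric.denseRange_iff.2 fun f r hr => ?_
  obtain ⟨h, hh, -⟩ := f.continuous.exists_contMDiff_approx (𝓡 d) ⊤
    (continuous_const (y := r)) fun _ => hr
  refine ⟨h, (ContinuousMap.dist_lt_iff hr).2 fun x => ?_⟩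
  rw [dist_comm]
  exact hh x

/-- The drift operator as a linear map into the continuous functions. -/
def driftMap (g : Metric d M) {b : ∀ x : M, TangentSpace (𝓡 d) x} (hb : HasC1Components b) :
    SmoothFn d M →ₗ[ℝ] C(M, ℝ) where
  toFun f := ⟨driftOp g b f, by
    simpa only [← driftOp_eq_mvfderiv g] using hb.continuous_mvfderiv (contMDiff_one f)⟩
  map_add' f h := by
    ext x
    simp [driftOp, grad_smoothFn_add]
  map_smul' c f := by
    ext x
    simp [driftOp, grad_smoothFn_smul]

variable [CompactSpace M] [MeasurableSpace M] [BorelSpace M]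

/-- The class in `L²` of a continuous function. -/
def toL2 (g : Metric d M) (U : M → ℝ) [IsFiniteMeasure (gibbsMeasure g U)] :
    C(M, ℝ) →L[ℝ] L2 g U :=
  have := secondCountableTopology_of_compact d M
  ContinuousMap.toLp 2 (gibbsMeasure g U) ℝ

theorem coeFn_toL2 (g : Metric d M) (U : M → ℝ) [IsFiniteMeasure (gibbsMeasure g U)]
    (f : C(M, ℝ)) : toL2 g U f =ᵐ[gibbsMeasure g U] f :=
  have := secondCountableTopology_of_compact d M
  ContinuousMap.coeFn_toLp (gibbsMeasure g U) f

theorem denseRange_toL2 [T2Space M] (g : Metric d M) (U : M → ℝ) [IsFiniteMeasure (gibbsMeasure g U)] :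
    DenseRange (toL2 g U) := by
  have := secondCountableTopology_of_compact d M
  let _ : MetricSpace M := TopologicalSpace.metrizableSpaceMetric M
  exact ContinuousMap.toLp_denseRange ℝ (gibbsMeasure g U) ℝ ENNReal.ofNat_ne_top

theorem inner_toL2_right (g : Metric d M) (U : M → ℝ) [IsFiniteMeasure (gibbsMeasure g U)]
    (u : L2 g U) (f : C(M, ℝ)) :
    ⟪u, toL2 g U f⟫_ℝ = ∫ x, u x * f x ∂gibbsMeasure g U := by
  rw [MeasureTheory.L2.inner_def]
  refine integral_congr_ae ?_
  filter_upwards [coeFn_toL2 g U f] with x hx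
  rw [hx]
  simp [mul_comm]

theorem inner_toL2_toL2 (g : Metric d M) (U : M → ℝ) [IsFiniteMeasure (gibbsMeasure g U)]
    (f h : C(M, ℝ)) :
    ⟪toL2 g U f, toL2 g U h⟫_ℝ = ∫ x, f x * h x ∂gibbsMeasure g U := by
  rw [inner_toL2_right]
  refine integral_congr_ae ?_
  filter_upwards [coeFn_toL2 g U f] with x hx
  rw [hx]

/-- Links convergence in the topology of `L2` to the `eLpNorm` conditions used for `H¹` and the
drift graph. -/
theorem tendsto_toL2_iff (g : Metric d M) (U : M → ℝ) [IsFiniteMeasure (gibbsMeasure g U)]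
    (f : ℕ → C(M, ℝ)) (u : L2 g U) :
    Tendsto (fun n => toL2 g U (f n)) atTop (𝓝 u) ↔
      Tendsto (fun n => eLpNorm (fun x => f n x - u x) 2 (gibbsMeasure g U)) atTop (𝓝 0) := by
  rw [tendsto_iff_edist_tendsto_0]
  refine tendsto_congr fun n => ?_
  rw [Lp.edist_def]
  refine eLpNorm_congr_ae ?_
  filter_upwards [coeFn_toL2 g U (f n)] with x hx
  simp [hx]

theorem integrable_of_continuous {μ : Measure M} [IsFiniteMeasure μ] {h : M → ℝ}
    (hh : Continuous h) : Integrable h μ :=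
  hh.integrable_of_hasCompactSupport (HasCompactSupport.of_compactSpace _)

/-- The form `∫ ∇f · ∇h dπ` on smooth functions. -/
def dirichletForm (g : Metric d M) (U : M → ℝ) [IsFiniteMeasure (gibbsMeasure g U)] :
    SmoothFn d M →ₗ[ℝ] SmoothFn d M →ₗ[ℝ] ℝ :=
  LinearMap.mk₂ ℝ (fun f h => ∫ x, gradInner g f h x ∂gibbsMeasure g U)
    (fun f f' h => by
      rw [← integral_add (integrable_of_continuous (continuous_gradInner g f h))
        (integrable_of_continuous (continuous_gradInner g f' h))]
      simp [gradInner, grad_smoothFn_add])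
    (fun c f h => by
      rw [smul_eq_mul, ← integral_const_mul]
      simp [gradInner, grad_smoothFn_smul])
    (fun f h h' => by
      rw [← integral_add (integrable_of_continuous (continuous_gradInner g f h))
        (integrable_of_continuous (continuous_gradInner g f h'))]
      simp [gradInner, grad_smoothFn_add])
    (fun c f h => by
      rw [smul_eq_mul, ← integral_const_mul]
      simp [gradInner, grad_smoothFn_smul])

/-- The Dirichlet form of `(M, g, U)` with the drift `b`. -/
def manifoldForm [T2Space M] (g : Metric d M) {U : M → ℝ} (hU : ContMDiff (𝓡 d) 𝓘(ℝ, ℝ) 1 U)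
    [IsFiniteMeasure (gibbsMeasure g U)] {b : ∀ x : M, TangentSpace (𝓡 d) x}
    (hb : HasC1Components b) {C : ℝ} (hC : ∀ x, g.inner x (b x) (b x) ≤ C)
    (hdiv : ∀ x : M, divergence g (fun y => Real.exp (-U y) • b y) x = 0) :
    DriftForm (SmoothFn d M) (L2 g U) where
  emb := (toL2 g U).toLinearMap ∘ₗ smoothToContinuous d M
  form := dirichletForm g U
  gen v := toL2 g U ⟨diffOp g U v, continuous_diffOp g hU v.contMDiff⟩
  drift := (toL2 g U).toLinearMap ∘ₗ driftMap g hb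
  bound := C
  denseRange_emb := (denseRange_toL2 g U).comp denseRange_smoothToContinuous
    (toL2 g U).continuous
  form_symm f v :=
    integral_congr_ae (Eventually.of_forall fun x => g.symm x _ _)
  form_nonneg f := integral_nonneg fun x => inner_self_nonneg_of_metric g x _
  form_eq f v := by
    change _ = -⟪toL2 g U _, toL2 g U _⟫_ℝ
    rw [inner_toL2_toL2]
    exact integral_inner_grad g hU (contMDiff_one f) v.contMDiff
  norm_drift_sq_le f := by
    rw [← real_inner_self_eq_norm_sq]
    change ⟪toL2 g U _, toL2 g U _⟫_ℝ ≤ C * ∫ x, gradInner g f f x ∂gibbsMeasure g U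
    rw [inner_toL2_toL2, ← integral_const_mul]
    refine integral_mono (integrable_of_continuous (by fun_prop))
      ((integrable_of_continuous (continuous_gradInner g f f)).const_mul C) fun x => ?_
    have h1 := inner_sq_le g x (b x) (grad g f x)
    have h2 : 0 ≤ gradInner g f f x := inner_self_nonneg_of_metric g x _
    change g.inner x (b x) (grad g f x) * g.inner x (b x) (grad g f x) ≤ C * gradInner g f f x
    rw [← sq]
    exact h1.trans (mul_le_mul_of_nonneg_right (hC x) h2)
  inner_drift f v := by
    change ⟪toL2 g U _, toL2 g U _⟫_ℝ = -⟪toL2 g U _, toL2 g U _⟫_ℝ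
    rw [inner_toL2_toL2, inner_toL2_toL2]
    exact integral_driftOp_mul g hU hb hdiv (contMDiff_one f) (contMDiff_one v)

/-! ### Agreement of the abstract and the geometric closed forms and graphs -/

section Translate

variable [T2Space M] (g : Metric d M) {U : M → ℝ} (hU : ContMDiff (𝓡 d) 𝓘(ℝ, ℝ) 1 U)
  [IsFiniteMeasure (gibbsMeasure g U)] {b : ∀ x : M, TangentSpace (𝓡 d) x}
  (hb : HasC1Components b) {C : ℝ} (hC : ∀ x, g.inner x (b x) (b x) ≤ C)
  (hdiv : ∀ x : M, divergence g (fun y => Real.exp (-U y) • b y) x = 0)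

theorem manifoldForm_isApprox_iff (f : ℕ → SmoothFn d M) (u : L2 g U) :
    (manifoldForm g hU hb hC hdiv).IsApprox f u ↔ IsH1Approx g U f u :=
  and_congr (tendsto_toL2_iff g U (fun n => smoothToContinuous d M (f n)) u) Iff.rfl

theorem manifoldForm_closedForm (u : L2 g U) :
    (manifoldForm g hU hb hC hdiv).closedForm u = energy g U u := by
  simp only [DriftForm.closedForm, manifoldForm_isApprox_iff]
  rfl

theorem manifoldForm_sumGraph (c : ℝ) :
    (manifoldForm g hU hb hC hdiv).sumGraph c = generatorGraph g U b c := by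
  have h1 : (manifoldForm g hU hb hC hdiv).genGraph = friedrichsGraph g U := by
    ext p
    simp only [DriftForm.genGraph, DriftForm.formDomain, manifoldForm_isApprox_iff]
    refine and_congr Iff.rfl (forall_congr' fun v => ?_)
    change ⟪p.1, toL2 g U _⟫_ℝ = ⟪p.2, toL2 g U _⟫_ℝ ↔ _
    rw [inner_toL2_right, inner_toL2_right]
    rfl
  have h2 : (manifoldForm g hU hb hC hdiv).driftClosure = driftGraph g U b := by
    ext p
    refine exists_congr fun f => and_congr (manifoldForm_isApprox_iff g hU hb hC hdiv f p.1) ?_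
    exact tendsto_toL2_iff g U (fun n => driftMap g hb (f n)) p.2
  rw [DriftForm.sumGraph, h1, h2, generatorGraph]

end Translate

end Assembly

end DriftHomogenization

end
-- The homogenization theorem on the manifold
theorem mainTheorem2 {d : ℕ} {M : Type*} [TopologicalSpace M] [T2Space M] [CompactSpace M]
    [ChartedSpace (EuclideanSpace ℝ (Fin d)) M] [IsManifold (𝓡 d) ∞ M]
    [MeasurableSpace M] [BorelSpace M]
    (g : DriftHomogenization.Metric d M)
    (U : M → ℝ) (hU : ContMDiff (𝓡 d) 𝓘(ℝ, ℝ) 1 U)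
    [IsProbabilityMeasure (DriftHomogenization.gibbsMeasure g U)]
    (b : ∀ x : M, TangentSpace (𝓡 d) x)
    (hb : ContMDiff (𝓡 d) (𝓡 d).tangent 1 (fun x => (⟨x, b x⟩ : TangentBundle (𝓡 d) M)))
    (hdiv : ∀ x : M,
      DriftHomogenization.divergence g (fun y => Real.exp (-U y) • b y) x = 0) :
    ∃ (Rc : ℝ → ℝ → DriftHomogenization.L2 g U →L[ℝ] DriftHomogenization.L2 g U)
      (Rlim : ℝ → DriftHomogenization.L2 g U →L[ℝ] DriftHomogenization.L2 g U),
      -- `Rc c lam` is the resolvent of `A_c` at `lam`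
      (∀ c lam : ℝ, 0 < lam →
        DriftHomogenization.IsResolventAt (DriftHomogenization.generatorGraph g U b c) lam
          (Rc c lam)) ∧
      -- `Rlim lam` is the limit of the resolvents in `H¹` as `|c| → ∞`
      (∀ lam : ℝ, 0 < lam → ∀ f : DriftHomogenization.L2 g U,
        Tendsto (fun c : ℝ => DriftHomogenization.h1NormSq g U (Rc c lam f - Rlim lam f))
          (comap (fun c : ℝ => |c|) atTop) (𝓝 0)) ∧
      -- the resolvent identity
      (∀ lam mu : ℝ, 0 < lam → 0 < mu →
        (mu - lam) • (Rlim lam ∘L Rlim mu) = Rlim lam - Rlim mu) ∧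
      -- the adjoint relation and self-adjointness
      (∀ c lam : ℝ, 0 < lam → ContinuousLinearMap.adjoint (Rc c lam) = Rc (-c) lam) ∧
      (∀ lam : ℝ, 0 < lam → IsSelfAdjoint (Rlim lam)) ∧
      -- the orthogonal complement of the constant functions is invariant
      (∀ lam : ℝ, 0 < lam → ∀ f : DriftHomogenization.L2 g U,
        ∫ x, f x ∂(DriftHomogenization.gibbsMeasure g U) = 0 →
          (∀ c : ℝ, ∫ x, Rc c lam f x ∂(DriftHomogenization.gibbsMeasure g U) = 0) ∧
          ∫ x, Rlim lam f x ∂(DriftHomogenization.gibbsMeasure g U) = 0) := by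
  have hbc := DriftHomogenization.hasC1Components_of_contMDiff hb
  obtain ⟨C, hC⟩ := DriftHomogenization.exists_bound_inner_self g hb
  let Q := DriftHomogenization.manifoldForm g hU hbc hC hdiv
  let one : DriftHomogenization.SmoothFn d M := ⟨fun _ => 1, contMDiff_const⟩
  -- The constant `1` has zero gradient, and pairing with it is integration against the Gibbs
  -- measure; so the invariance of its orthogonal complement is preservation of mean zero.
  have hone : ∀ v, Q.form one v = 0 := fun v => by
    change ∫ x, g.inner x (DriftHomogenization.grad g one x) (DriftHomogenization.grad g v x)
      ∂DriftHomogenization.gibbsMeasure g U = 0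
    have h0 : ∀ x, DriftHomogenization.grad g one x = 0 := fun x => by
      have : mvfderiv (𝓡 d) one x = 0 := mvfderiv_const (1 : ℝ)
      simp [DriftHomogenization.grad, this]
    simp [h0]
  have hmean : ∀ f : DriftHomogenization.L2 g U, inner ℝ (Q.emb one) f =
      ∫ x, f x ∂DriftHomogenization.gibbsMeasure g U := fun f => by
    rw [real_inner_comm]
    refine (DriftHomogenization.inner_toL2_right g U f _).trans ?_
    refine integral_congr_ae (Eventually.of_forall fun x => ?_)
    exact mul_one _
  obtain ⟨Rc, Rlim, h1, h2, h3, h4, h5, h6⟩ := Q.exists_resolvent_family hone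
  refine ⟨Rc, Rlim, fun c lam hlam => ?_, fun lam hlam f => ?_, h3, h4, h5, fun lam hlam f hf => ?_⟩
  · rw [← DriftHomogenization.manifoldForm_sumGraph g hU hbc hC hdiv]
    exact h1 c lam hlam
  · simp only [DriftHomogenization.h1NormSq,
      ← DriftHomogenization.manifoldForm_closedForm g hU hbc hC hdiv]
    exact h2 lam hlam f
  · simpa only [hmean] using h6 lam hlam f (by rwa [hmean])
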